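/- Let $\mathbb{C}[x,\partial]$, $\partial=d/dx$, be the algebra of polynomial differential operators in one variable, regarded as a Lie algebra under the commutator, and let $U(\mathbb{C}[x,\partial])$ be its universal enveloping algebra, with canonical map $\iota:\mathbb{C}[x,\partial]\to U(\mathbb{C}[x,\partial])$. For polynomials $s_1,s_2\in\mathbb{C}[K]$ let $A_{s_1,s_2}$ be the associative unital $\mathbb{C}$-algebra with generators $K,q,p,e,f,r$ and defining relations (where $[a,b]=ab-ba$, $\mathrm{ad}_a(b)=[a,b]$) $$[K,X]=0 \text{ for every generator } X,\quad [p,q]=K,\quad [f,q]=p,\quad [p,f]=0,\quad [e,p]=q,\quad [[f,e],f]=2f,$$ $$[r,p]=e,\quad [e,r]=0,\quad \mathrm{ad}_f^4(r)=0,\quad [e,[f,r]]=3r,$$ $$[r,\mathrm{ad}_f^3(r)]-[\mathrm{ad}_f(r),\mathrm{ad}_f^2(r)]=-\tfrac12 s_1K,\qquad \mathrm{ad}_r^3(f)=0,$$ $$4[\mathrm{ad}_f^3(r),\mathrm{ad}_r^2(f)]-3[\mathrm{ad}_f^2(r),\mathrm{ad}_f\mathrm{ad}_r^2(f)]+2[\mathrm{ad}_f(r),\mathrm{ad}_f^2\mathrm{ad}_r^2(f)]-[r,\mathrm{ad}_f^3\mathrm{ad}_r^2(f)]=15s_1q,$$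 $$3[\mathrm{ad}_f^2\mathrm{ad}_r^2(f),\mathrm{ad}_f\mathrm{ad}_r^2(f)]-2[\mathrm{ad}_f^3\mathrm{ad}_r^2(f),\mathrm{ad}_r^2(f)]=3\big((30s_1+14s_2K)e+7s_2q^2\big).$$ Then: (1) There is an isomorphism of associative unital $\mathbb{C}$-algebras $A_{1,0}\to U(\mathbb{C}[x,\partial])$ that sends $K,q,p,e,f,r$ to the images under $\iota$ of $1,\ x,\ \partial,\ -\tfrac{x^2}{2},\ \tfrac{\partial^2}{2},\ \tfrac{x^3}{6}$, respectively. (2) The value $s_1=1$ is determined by one relation: for $s_1\in\mathbb{C}[K]$, the elements $K=\iota(1)$, $f=\iota(\tfrac{\partial^2}{2})$, $r=\iota(\tfrac{x^3}{6})$ of $U(\mathbb{C}[x,\partial])$ satisfy $$[r,\mathrm{ad}_f^3(r)]-[\mathrm{ad}_f(r),\mathrm{ad}_f^2(r)]=-\tfrac12 s_1(K)K$$ if and only if $s_1=1$. -/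

import Mathlib

open Polynomial

attribute [local instance 100] LieRing.ofAssociativeRing

noncomputable section

namespace DDCA

/-- Multiplication by `x` on `ℂ[x]`. -/
def mulX : Module.End ℂ ℂ[X] := LinearMap.mulLeft ℂ (X : ℂ[X])

/-- The derivation `∂ = d/dx` on `ℂ[x]`. -/
def ddx : Module.End ℂ ℂ[X] := Polynomial.derivative

/-- The algebra `ℂ[x, ∂]` of polynomial differential operators in one variable: the subalgebra of
`End_ℂ ℂ[x]` generated by multiplication by `x` and by `∂ = d/dx`. As with every associative
algebra, its Lie bracket is the commutator. -/
abbrev DiffOp : Subalgebra ℂ (Module.End ℂ ℂ[X]) := Algebra.adjoin ℂ {mulX, ddx}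

/-- The operator `x` as an element of `ℂ[x, ∂]`. -/
def opX : DiffOp := ⟨mulX, Algebra.subset_adjoin (by simp)⟩

/-- The operator `∂` as an element of `ℂ[x, ∂]`. -/
def opD : DiffOp := ⟨ddx, Algebra.subset_adjoin (by simp)⟩

/-- The universal enveloping algebra `U(ℂ[x, ∂])` of the Lie algebra `ℂ[x, ∂]`. -/
abbrev UDiffOp : Type := UniversalEnvelopingAlgebra ℂ DiffOp

/-- The canonical Lie algebra map `ℂ[x, ∂] → U(ℂ[x, ∂])`. -/
abbrev toU : DiffOp →ₗ⁅ℂ⁆ UDiffOp := UniversalEnvelopingAlgebra.ι ℂ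

/-- `adPow a n b = ad_a^n (b)`, for the commutator bracket of a ring. -/
def adPow {A : Type*} [Ring A] (a : A) (n : ℕ) (b : A) : A := (fun y => ⁅a, y⁆)^[n] b

/-- The expression `[r, ad_f^3 (r)] - [ad_f (r), ad_f^2 (r)]`. -/
def phiElt {A : Type*} [Ring A] (f r : A) : A :=
  ⁅r, adPow f 3 r⁆ - ⁅adPow f 1 r, adPow f 2 r⁆

/-- The names of the six generators of `A_{s₁, s₂}`. -/
inductive Gen : Type
  | K | q | p | e | f | r

/-- The free associative unital algebra on the six generators. -/
abbrev FreeA : Type := FreeAlgebra ℂ Gen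

/-- A generator in the free algebra. -/
abbrev g (i : Gen) : FreeA := FreeAlgebra.ι ℂ i

open Gen in
/-- The defining relations of `A_{s₁, s₂}`, for `s₁, s₂ ∈ ℂ[K]`. -/
inductive Rel (s₁ s₂ : ℂ[X]) : FreeA → FreeA → Prop
  | K_central (i : Gen) : Rel s₁ s₂ ⁅g K, g i⁆ 0
  | p_q : Rel s₁ s₂ ⁅g p, g q⁆ (g K)
  | f_q : Rel s₁ s₂ ⁅g f, g q⁆ (g p)
  | p_f : Rel s₁ s₂ ⁅g p, g f⁆ 0
  | e_p : Rel s₁ s₂ ⁅g e, g p⁆ (g q)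
  | f_e_f : Rel s₁ s₂ ⁅⁅g f, g e⁆, g f⁆ (2 * g f)
  | r_p : Rel s₁ s₂ ⁅g r, g p⁆ (g e)
  | e_r : Rel s₁ s₂ ⁅g e, g r⁆ 0
  | f_f_f_f_r : Rel s₁ s₂ (adPow (g f) 4 (g r)) 0
  | e_f_r : Rel s₁ s₂ ⁅g e, ⁅g f, g r⁆⁆ (3 * g r)
  | phi : Rel s₁ s₂ (phiElt (g f) (g r)) (-((1 / 2 : ℂ) • (aeval (g K) s₁ * g K)))
  | r_r_r_f : Rel s₁ s₂ (adPow (g r) 3 (g f)) 0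
  | psi : Rel s₁ s₂
      (4 * ⁅adPow (g f) 3 (g r), adPow (g r) 2 (g f)⁆
        - 3 * ⁅adPow (g f) 2 (g r), adPow (g f) 1 (adPow (g r) 2 (g f))⁆
        + 2 * ⁅adPow (g f) 1 (g r), adPow (g f) 2 (adPow (g r) 2 (g f))⁆
        - ⁅g r, adPow (g f) 3 (adPow (g r) 2 (g f))⁆)
      (15 * aeval (g K) s₁ * g q)
  | chi : Rel s₁ s₂
      (3 * ⁅adPow (g f) 2 (adPow (g r) 2 (g f)), adPow (g f) 1 (adPow (g r) 2 (g f))⁆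
        - 2 * ⁅adPow (g f) 3 (adPow (g r) 2 (g f)), adPow (g r) 2 (g f)⁆)
      (3 * ((30 * aeval (g K) s₁ + 14 * aeval (g K) s₂ * g K) * g e
        + 7 * aeval (g K) s₂ * g q ^ 2))

/-- The associative unital algebra `A_{s₁, s₂}`, given by generators and relations. -/
abbrev AlgA (s₁ s₂ : ℂ[X]) : Type := RingQuot (Rel s₁ s₂)

/-- The images of the generators in `A_{s₁, s₂}`. -/
def AlgA.gen (s₁ s₂ : ℂ[X]) (i : Gen) : AlgA s₁ s₂ := RingQuot.mkAlgHom ℂ (Rel s₁ s₂) (g i)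

end DDCA

end

/-! Since $A_{1,0}$ is given by Lie relations between its generators, it should be the enveloping
algebra of the Lie algebra they generate, and the point is that this Lie algebra is no larger than
$\mathbb{C}[x,\partial]$. A `DiffOpTuple` is a solution of the relations in any complex Lie algebra.
Inside it one builds candidates `t k` for $x^k$ and `w j k` $=\mathrm{ad}_f^j(t_k)$, and shows that
they behave as in $\mathbb{C}[x,\partial]$.

The core is `act`: an induction on `k` that computes how $s_i=\mathrm{ad}_f^i(r)$ brackets with `t
k`. With `w_eq_zero` this shows that the span `M` of the `b (i, j)` contains the Lie subalgebra
`sub` generated by `q`, `f`, `r` (`sub_le_M`). Bracketing with `p` and `q` lowers the indices of `b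
(i, j)`, so a nonzero element of `M` can be brought down to `K` (`K_mem_of_mem_M`). Hence a Lie map
that does not kill `K` is injective on `sub`; independence of the `b (i, j)` in `L` is never
assumed.

Applied to $A_{1,0}\to\mathbb{C}[x,\partial]$, this makes `sub` isomorphic to
$\mathbb{C}[x,\partial]$, because $x,\partial^2,x^3$ generate the latter as a Lie algebra. The
inverse extends to $U(\mathbb{C}[x,\partial])$ by its universal property and inverts the evident map
(`exists_algEquiv`). No PBW theorem is needed.

For (2), the relation becomes $s_1(K)K=K$. On the tensor powers of $\mathbb{C}[x]$ the element $K$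
acts by $1,2,3,\dots$, so $s_1-1$ has infinitely many roots. -/

/-- Elements of a complex Lie algebra that satisfy the relations of `1, x, ∂, -x²/2, ∂²/2, x³/6`
in the Lie algebra of polynomial differential operators. -/
structure DiffOpTuple (L : Type*) [LieRing L] [LieAlgebra ℂ L] where
  K : L
  q : L
  p : L
  e : L
  f : L
  r : L
  lie_K : ∀ x : L, ⁅K, x⁆ = 0
  lie_p_q : ⁅p, q⁆ = K
  lie_f_q : ⁅f, q⁆ = p
  lie_p_f : ⁅p, f⁆ = 0
  lie_e_p : ⁅e, p⁆ = q
  lie_f_e_f : ⁅⁅f, e⁆, f⁆ = (2 : ℂ) • f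
  lie_r_p : ⁅r, p⁆ = e
  lie_e_r : ⁅e, r⁆ = 0
  lie_f_f_f_f_r : ⁅f, ⁅f, ⁅f, ⁅f, r⁆⁆⁆⁆ = 0
  lie_e_f_r : ⁅e, ⁅f, r⁆⁆ = (3 : ℂ) • r
  phi : ⁅r, ⁅f, ⁅f, ⁅f, r⁆⁆⁆⁆ - ⁅⁅f, r⁆, ⁅f, ⁅f, r⁆⁆⁆ = (-(1 / 2) : ℂ) • K
  lie_r_r_r_f : ⁅r, ⁅r, ⁅r, f⁆⁆⁆ = 0
  psi : (4 : ℂ) • ⁅⁅f, ⁅f, ⁅f, r⁆⁆⁆, ⁅r, ⁅r, f⁆⁆⁆ - (3 : ℂ) • ⁅⁅f, ⁅f, r⁆⁆, ⁅f, ⁅r, ⁅r, f⁆⁆⁆⁆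
    + (2 : ℂ) • ⁅⁅f, r⁆, ⁅f, ⁅f, ⁅r, ⁅r, f⁆⁆⁆⁆⁆ - ⁅r, ⁅f, ⁅f, ⁅f, ⁅r, ⁅r, f⁆⁆⁆⁆⁆⁆ = (15 : ℂ) • q
  chi : (3 : ℂ) • ⁅⁅f, ⁅f, ⁅r, ⁅r, f⁆⁆⁆⁆, ⁅f, ⁅r, ⁅r, f⁆⁆⁆⁆
    - (2 : ℂ) • ⁅⁅f, ⁅f, ⁅f, ⁅r, ⁅r, f⁆⁆⁆⁆⁆, ⁅r, ⁅r, f⁆⁆⁆ = (90 : ℂ) • e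

namespace DiffOpTuple

variable {L : Type*} [LieRing L] [LieAlgebra ℂ L] (G : DiffOpTuple L)

/-- The element corresponding to `ad_f ^ i (x³/6)`. -/
def s : ℕ → L
  | 0 => G.r
  | i + 1 => ⁅G.f, s i⁆

/-- The element corresponding to `x ^ k`. -/
noncomputable def t : ℕ → L
  | 0 => G.K
  | 1 => G.q
  | 2 => (-2 : ℂ) • G.e
  | 3 => (6 : ℂ) • G.r
  -- `s 1` stands for $\tfrac12(x^2\partial+x)$, and $[\tfrac12(x^2\partial+x),x^k]=\tfrac
  -- k2x^{k+1}$.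
  | n + 4 => (2 / (n + 3) : ℂ) • ⁅G.s 1, t (n + 3)⁆

lemma s_zero : G.s 0 = G.r := rfl

lemma lie_f_s (i : ℕ) : ⁅G.f, G.s i⁆ = G.s (i + 1) := rfl

lemma t_zero : G.t 0 = G.K := rfl

lemma t_one : G.t 1 = G.q := rfl

lemma t_two : G.t 2 = (-2 : ℂ) • G.e := rfl

lemma t_three : G.t 3 = (6 : ℂ) • G.s 0 := rfl

lemma t_add_four (n : ℕ) : G.t (n + 4) = (2 / (n + 3) : ℂ) • ⁅G.s 1, G.t (n + 3)⁆ := rfl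

lemma s_four : G.s 4 = 0 := G.lie_f_f_f_f_r

lemma lie_K_right (x : L) : ⁅x, G.K⁆ = 0 := by rw [← lie_skew, G.lie_K, neg_zero]

lemma lie_s_lie_f (i : ℕ) (x : L) : ⁅G.s i, ⁅G.f, x⁆⁆ = ⁅G.f, ⁅G.s i, x⁆⁆ - ⁅G.s (i + 1), x⁆ := by
  rw [leibniz_lie, ← lie_skew (G.s i), lie_f_s, neg_lie]; abel

/-! ### Weights and brackets of low degree -/

/-- The weight element, corresponding to `x∂ + 1/2`. -/
def h : L := ⁅G.e, G.f⁆

lemma lie_h_f : ⁅G.h, G.f⁆ = (-2 : ℂ) • G.f := by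
  rw [h, ← lie_skew G.e, neg_lie, G.lie_f_e_f, neg_smul]

lemma lie_h_r : ⁅G.h, G.r⁆ = (3 : ℂ) • G.r := by
  rw [h, lie_lie, G.lie_e_f_r, G.lie_e_r, lie_zero, sub_zero]

lemma lie_f_p : ⁅G.f, G.p⁆ = 0 := by rw [← lie_skew, G.lie_p_f, neg_zero]

lemma lie_h_p : ⁅G.h, G.p⁆ = -G.p := by
  rw [h, lie_lie, G.lie_f_p, G.lie_e_p, G.lie_f_q, lie_zero, zero_sub]

lemma lie_h_e : ⁅G.h, G.e⁆ = (2 : ℂ) • G.e := by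
  rw [← G.lie_r_p, leibniz_lie, G.lie_h_r, G.lie_h_p, smul_lie, lie_neg]
  module

lemma lie_h_q : ⁅G.h, G.q⁆ = G.q := by
  rw [← G.lie_e_p, leibniz_lie, G.lie_h_e, G.lie_h_p, smul_lie, lie_neg]
  module

lemma lie_h_s (i : ℕ) : ⁅G.h, G.s i⁆ = (3 - 2 * i : ℂ) • G.s i := by
  induction i with
  | zero => simp [s_zero, lie_h_r]
  | succ i ih =>
    rw [← lie_f_s, leibniz_lie, ih, lie_h_f, smul_lie, lie_smul]
    push_cast
    module

lemma lie_e_s_succ (i : ℕ) :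
    ⁅G.e, G.s (i + 1)⁆ = ((i + 1) * (3 - i) : ℂ) • G.s i := by
  induction i with
  | zero => rw [← lie_f_s, s_zero]; simpa using G.lie_e_f_r
  | succ i ih =>
    rw [← lie_f_s, leibniz_lie, ← h, lie_h_s, ih, lie_smul, lie_f_s]
    push_cast
    module

lemma lie_p_r : ⁅G.p, G.r⁆ = -G.e := by rw [← lie_skew, G.lie_r_p]

lemma lie_p_s_one : ⁅G.p, G.s 1⁆ = G.h := by
  rw [← lie_f_s, s_zero, leibniz_lie, G.lie_p_f, lie_p_r, zero_lie, zero_add, lie_neg, h, lie_skew]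

lemma lie_r_q : ⁅G.r, G.q⁆ = 0 := by
  rw [← G.lie_e_p, leibniz_lie, G.lie_r_p, lie_self, add_zero, ← lie_skew G.r, G.lie_e_r]
  simp

lemma lie_s_one_q : ⁅G.s 1, G.q⁆ = -G.e := by
  have h := G.lie_s_lie_f 0 G.q
  rw [G.lie_f_q, s_zero, G.lie_r_p, G.lie_r_q, lie_zero, zero_sub] at h
  rw [h, neg_neg]

lemma lie_s_succ_p (i : ℕ) : ⁅G.s (i + 1), G.p⁆ = ⁅G.f, ⁅G.s i, G.p⁆⁆ := by
  have h := G.lie_s_lie_f i G.p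
  rw [G.lie_f_p, lie_zero] at h
  exact (sub_eq_zero.1 h.symm).symm

lemma lie_s_succ_q (i : ℕ) : ⁅G.s (i + 1), G.q⁆ = ⁅G.f, ⁅G.s i, G.q⁆⁆ - ⁅G.s i, G.p⁆ := by
  rw [← G.lie_f_q, lie_s_lie_f]; abel

lemma lie_f_f_e : ⁅G.f, ⁅G.f, G.e⁆⁆ = (-2 : ℂ) • G.f := by
  rw [← lie_skew, G.lie_f_e_f, neg_smul]

lemma lie_s_two_q : ⁅G.s 2, G.q⁆ = (-2 : ℂ) • ⁅G.f, G.e⁆ := by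
  rw [lie_s_succ_q, lie_s_succ_p, lie_s_one_q, s_zero, G.lie_r_p, lie_neg]
  module

lemma lie_s_three_q : ⁅G.s 3, G.q⁆ = (6 : ℂ) • G.f := by
  rw [lie_s_succ_q, lie_s_succ_p, lie_s_succ_p, lie_s_two_q, s_zero, G.lie_r_p, lie_smul,
    lie_f_f_e]
  module

/-! ### The action of $\mathrm{ad}_f^i(r)$ on the powers of $x$ -/

/-- The expected action of the `s i` on `t k`. -/
structure Act (k : ℕ) : Prop where
  h0 : ⁅G.s 0, G.t k⁆ = 0
  h1 : ⁅G.s 1, G.t k⁆ = (k / 2 : ℂ) • G.t (k + 1)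
  h2 : ⁅G.s 2, G.t k⁆ = (2 * k / (k + 1) : ℂ) • ⁅G.f, G.t (k + 1)⁆
  -- `s 3` stands for $\partial^3$. The last term is a noncommutative correction; its coefficient
  -- vanishes for `k < 3`, so the truncation in `k - 3` is harmless.
  h3 : ⁅G.s 3, G.t k⁆ = (3 / (k + 1) : ℂ) • ⁅G.f, ⁅G.f, G.t (k + 1)⁆⁆
    + (k * (k - 1) * (k - 2) / 4 : ℂ) • G.t (k - 3)

lemma act_zero : G.Act 0 := by
  constructor <;> simp [t_zero, t_one, lie_K_right, G.lie_f_q, lie_f_p]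

lemma act_one : G.Act 1 := by
  constructor
  · exact G.lie_r_q
  · simp only [t_one, Nat.reduceAdd, t_two, lie_s_one_q]; push_cast; module
  · simp only [t_one, Nat.reduceAdd, t_two, lie_s_two_q, lie_smul]; push_cast; module
  · simp only [t_one, Nat.reduceAdd, t_two, lie_s_three_q, lie_smul, lie_f_f_e]; push_cast; module

lemma lie_s_succ_e (i : ℕ) : ⁅G.s (i + 1), G.e⁆ = (-((i + 1) * (3 - i)) : ℂ) • G.s i := by
  rw [← lie_skew, lie_e_s_succ, neg_smul]

lemma act_two : G.Act 2 := by
  constructor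
  · rw [t_two, lie_smul, s_zero, ← lie_skew, G.lie_e_r]; simp
  all_goals
    simp only [t_two, Nat.reduceAdd, t_three, lie_smul, lie_s_succ_e, lie_f_s]
    push_cast
    module

lemma lie_s_one_t (n : ℕ) : ⁅G.s 1, G.t n⁆ = (n / 2 : ℂ) • G.t (n + 1) := by
  match n with
  | 0 => exact G.act_zero.h1
  | 1 => exact G.act_one.h1
  | 2 => exact G.act_two.h1
  | n + 3 =>
    have : (n + 3 : ℂ) ≠ 0 := by exact_mod_cast (by omega : n + 3 ≠ 0)
    rw [t_add_four]
    push_cast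
    match_scalars
    field_simp

lemma r_r_f : ⁅G.r, ⁅G.r, G.f⁆⁆ = (1 / 4 : ℂ) • G.t 4 := by
  have h : ⁅G.r, G.f⁆ = -G.s 1 := by rw [← lie_skew, ← lie_f_s, s_zero]
  rw [h, t_add_four, t_three, lie_smul, lie_neg, ← lie_skew, s_zero]
  push_cast
  module

lemma lie_s_zero_t_four : ⁅G.s 0, G.t 4⁆ = 0 := by
  have h := G.lie_r_r_r_f
  rw [r_r_f, lie_smul, smul_eq_zero] at h
  exact h.resolve_left (by norm_num)

lemma lie_s_zero_f_t {k : ℕ} (hk : ⁅G.s 0, G.t k⁆ = 0) :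
    ⁅G.s 0, ⁅G.f, G.t k⁆⁆ = -(k / 2 : ℂ) • G.t (k + 1) := by
  rw [lie_s_lie_f, hk, lie_s_one_t]; simp

/-- `x³∂` acts on powers of `x`. -/
lemma lie_lie_s_two_s_zero_t {a : ℕ} (ha : G.Act a) (ha' : ⁅G.s 0, G.t (a + 1)⁆ = 0) :
    ⁅⁅G.s 2, G.s 0⁆, G.t a⁆ = (a : ℂ) • G.t (a + 2) := by
  have : (a + 1 : ℂ) ≠ 0 := by exact_mod_cast (by omega : a + 1 ≠ 0)
  rw [lie_lie, ha.h0, ha.h2, lie_smul, lie_s_zero_f_t _ ha', lie_zero, smul_smul]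
  push_cast
  match_scalars
  field_simp

/-- The step that gives commutativity of the powers of `x`. -/
lemma lie_s_zero_t_step {k : ℕ} (h3 : G.Act 3) (hk0 : G.Act (k + 3))
    (hk1 : ⁅G.s 0, G.t (k + 4)⁆ = 0) : ⁅G.s 0, G.t (k + 5)⁆ = 0 := by
  have c3 : G.s 0 = (1 / 6 : ℂ) • G.t 3 := by rw [t_three]; module
  have c (m : ℕ) (h : ⁅G.s 0, G.t m⁆ = 0) : ⁅G.t 3, G.t m⁆ = 0 := by
    rw [t_three, smul_lie, h, smul_zero]
  -- Bracketing with `s 1` is a derivation that raises the index of `t` by one.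
  have D (a b : ℕ) (h : ⁅G.t a, G.t b⁆ = 0) :
      (a : ℂ) • ⁅G.t (a + 1), G.t b⁆ + (b : ℂ) • ⁅G.t a, G.t (b + 1)⁆ = 0 := by
    have h' := leibniz_lie (G.s 1) (G.t a) (G.t b)
    rw [h, lie_s_one_t, lie_s_one_t, lie_zero, smul_lie, lie_smul] at h'
    linear_combination (norm := module) (-2 : ℂ) • h'
  have e1 := D 3 (k + 3) (c _ hk0.h0)
  rw [c _ hk1] at e1
  have e1' : ⁅G.t 4, G.t (k + 3)⁆ = 0 := by
    simpa using e1
  have e2 := D 3 (k + 4) (c _ hk1)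
  have e3 := D 4 (k + 3) e1'
  have e4 := leibniz_lie ⁅G.s 2, G.s 0⁆ (G.t 3) (G.t (k + 3))
  rw [lie_lie_s_two_s_zero_t _ h3 G.lie_s_zero_t_four, lie_lie_s_two_s_zero_t _ hk0 hk1,
    c _ hk0.h0, lie_zero, smul_lie, lie_smul] at e4
  rw [c3, smul_lie]
  -- `e2`, `e3`, `e4` are three linear equations in $[t_5,t_{k+3}]$, $[t_4,t_{k+4}]$,
  -- $[t_3,t_{k+5}]$. Eliminating the first two leaves this nonzero factor.
  have : ((k + 3) * (k + 8) : ℂ) • ⁅G.t 3, G.t (k + 5)⁆ = 0 := by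
    push_cast at e2 e3 e4
    linear_combination (norm := module) (-4 : ℂ) • e4 + (-3 : ℂ) • e3 + (k + 3 : ℂ) • e2
  rw [smul_eq_zero] at this
  rw [this.resolve_left, smul_zero]
  exact_mod_cast (by positivity : (k + 3) * (k + 8) ≠ 0)

/-- Relation `phi` says that $[s_0,s_3]-[s_1,s_2]$ is a multiple of the central `K`, so it brackets
to zero with `t m`. Expanding by the known action on `t m` leaves $[s_2,t_{m+1}]$ as the only
unknown. -/
lemma lie_s_two_t_step {m : ℕ} (hm : G.Act m) (hk : ⁅G.s 0, G.t (m + 1)⁆ = 0)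
    (hm' : (m * (m - 1) * (m - 2) / 4 : ℂ) • ⁅G.s 0, G.t (m - 3)⁆ = 0) :
    ⁅G.s 2, G.t (m + 1)⁆ = (2 * (m + 1 : ℕ) / ((m + 1 : ℕ) + 1) : ℂ) • ⁅G.f, G.t (m + 1 + 1)⁆ := by
  have n1 : (m + 1 : ℂ) ≠ 0 := by exact_mod_cast (by omega : m + 1 ≠ 0)
  have n2 : (m + 2 : ℂ) ≠ 0 := by exact_mod_cast (by omega : m + 2 ≠ 0)
  have n3 : (m + 3 : ℂ) ≠ 0 := by exact_mod_cast (by omega : m + 3 ≠ 0)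
  have h := congrArg (fun x => ⁅x, G.t m⁆) G.phi
  change ⁅⁅G.s 0, G.s 3⁆ - ⁅G.s 1, G.s 2⁆, G.t m⁆ = ⁅(-(1 / 2) : ℂ) • G.K, G.t m⁆ at h
  simp only [sub_lie, smul_lie, lie_lie, G.lie_K, hm.h0, hm.h1, hm.h2, hm.h3, lie_add, lie_smul,
    lie_zero, lie_s_lie_f, hk, hm', lie_s_one_t, Nat.reduceAdd, zero_add, zero_sub,
    sub_zero, smul_zero, add_zero, lie_neg] at h
  rw [← sub_eq_zero]
  push_cast
  rw [add_assoc (m : ℂ), one_add_one_eq_two]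
  have : ((m + 2) * (m + 3) / (2 * (m + 1)) : ℂ) • (⁅G.s 2, G.t (m + 1)⁆
      - (2 * (m + 1) / (m + 2) : ℂ) • ⁅G.f, G.t (m + 2)⁆) = 0 := by
    rw [← sub_eq_zero] at h
    rw [← h]
    push_cast
    match_scalars <;> field_simp <;> ring
  exact (smul_eq_zero.1 this).resolve_left
    (div_ne_zero (mul_ne_zero n2 n3) (mul_ne_zero two_ne_zero n1))

lemma lie_h_t (k : ℕ) : ⁅G.h, G.t k⁆ = (k : ℂ) • G.t k := by
  match k with
  | 0 => simp [t_zero, lie_K_right]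
  | 1 => simp [t_one, lie_h_q]
  | 2 => rw [t_two, lie_smul, lie_h_e]; push_cast; module
  | 3 => rw [t_three, lie_smul, s_zero, lie_h_r]; push_cast; module
  | n + 4 =>
    rw [t_add_four, lie_smul, leibniz_lie, lie_h_s, lie_h_t (n + 3), smul_lie, lie_smul]
    push_cast
    module

lemma lie_e_t {k : ℕ} (hk : ∀ j < k, ⁅G.s 0, G.t j⁆ = 0) : ⁅G.e, G.t k⁆ = 0 := by
  match k with
  | 0 => exact G.lie_K_right _
  | 1 =>
    have h := congrArg (fun x => ⁅G.p, x⁆) G.lie_r_q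
    rwa [leibniz_lie, lie_p_r, G.lie_p_q, lie_K_right, lie_zero, neg_lie, add_zero,
      neg_eq_zero] at h
  | 2 => simp [t_two]
  | 3 => rw [t_three, lie_smul, s_zero, G.lie_e_r, smul_zero]
  | n + 4 =>
    rw [t_add_four, lie_smul, leibniz_lie, lie_e_s_succ, smul_lie, hk (n + 3) (by omega),
      lie_e_t fun j hj => hk j (by omega)]
    simp

lemma lie_p_t (k : ℕ) : ⁅G.p, G.t k⁆ = (k : ℂ) • G.t (k - 1) := by
  match k with
  | 0 => simp [t_zero, lie_K_right]
  | 1 => simp [t_one, t_zero, G.lie_p_q]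
  | 2 => rw [t_two, lie_smul, ← lie_skew, G.lie_e_p, t_one]; push_cast; module
  | 3 => rw [t_three, lie_smul, s_zero, lie_p_r, t_two]; push_cast; module
  | n + 4 =>
    have : (n + 3 : ℂ) ≠ 0 := by exact_mod_cast (by omega : n + 3 ≠ 0)
    rw [t_add_four, lie_smul, leibniz_lie, lie_p_s_one, lie_h_t, lie_p_t (n + 3), lie_smul,
      show n + 3 - 1 = n + 2 by omega, lie_s_one_t, show n + 4 - 1 = n + 3 by omega]
    push_cast
    match_scalars
    field_simp
    ring

/-- Since $t_3=6s_0$, the last clause concerns $[s_3,s_0]$. Applying $\mathrm{ad}_f^2$ to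
$[s_1,s_0]=\tfrac14t_4$ gives $[s_3,s_0]+[s_2,s_1]$, while `phi` gives the difference of these
brackets. -/
lemma act_three : G.Act 3 := by
  have h0 : ⁅G.s 0, G.t 3⁆ = 0 := by rw [t_three, lie_smul, lie_self, smul_zero]
  constructor
  · exact h0
  · exact G.lie_s_one_t 3
  · exact G.lie_s_two_t_step G.act_two h0 (by simp)
  · have h : ⁅G.s 0, G.s 3⁆ - ⁅G.s 1, G.s 2⁆ = (-(1 / 2) : ℂ) • G.K := G.phi
    have h1 : ⁅G.s 1, G.s 0⁆ = (1 / 4 : ℂ) • G.t 4 := by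
      rw [t_add_four, t_three, lie_smul]; push_cast; module
    have h2 := congrArg (fun x => ⁅G.f, x⁆) h1
    simp only [leibniz_lie G.f (G.s _), lie_smul, lie_f_s, Nat.reduceAdd,
      lie_self, zero_add, add_zero] at h2
    have h3 := congrArg (fun x => ⁅G.f, x⁆) h2
    simp only [leibniz_lie G.f (G.s _), lie_smul, lie_f_s, Nat.reduceAdd, zero_add] at h3
    rw [← lie_skew (G.s 0)] at h
    rw [← lie_skew (G.s 1)] at h
    simp only [Nat.reduceSub, Nat.reduceAdd, t_zero, lie_smul, t_three]
    push_cast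
    linear_combination (norm := module) (-3 : ℂ) • h + (3 : ℂ) • h3

lemma lie_s_zero_t_sub {m : ℕ} (h : ⁅G.s 0, G.t (m - 3)⁆ = 0) :
    (m * (m - 1) * (m - 2) / 4 : ℂ) • ⁅G.s 0, G.t (m - 3)⁆ = 0 := by rw [h, smul_zero]

/-- As $[r,[r,f]]=\tfrac14t_4$, relation `psi` contains $[s_3,t_4]$; its other brackets reduce to
$\mathrm{ad}_f^2(t_5)$. -/
lemma act_four : G.Act 4 := by
  have h0 := G.lie_s_zero_t_four
  have h2 := G.lie_s_two_t_step G.act_three h0 (by simp [G.act_zero.h0])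
  refine ⟨h0, G.lie_s_one_t 4, h2, ?_⟩
  have h := G.psi
  simp only [r_r_f] at h
  change _ • ⁅G.s 3, _⁆ - _ • ⁅G.s 2, _⁆ + _ • ⁅G.s 1, _⁆ - ⁅G.s 0, _⁆ = _ at h
  simp only [lie_smul, lie_s_lie_f, h0, h2, lie_s_one_t, Nat.reduceAdd, zero_add, lie_sub, lie_zero,
    zero_sub, lie_neg] at h
  simp only [Nat.reduceAdd, Nat.reduceSub, t_one]
  push_cast at h ⊢
  linear_combination (norm := module) (2 / 5 : ℂ) • h

/-- The value of $[s_3,t_5]$ comes from `chi`. Its left factors are rewritten as brackets of the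
$s_i$ and its right factors in terms of $t_4$, so that the Jacobi identity makes the known action
apply. -/
lemma act_five : G.Act 5 := by
  have h0 : ⁅G.s 0, G.t 5⁆ = 0 := G.lie_s_zero_t_step (k := 0) G.act_three G.act_three
    G.lie_s_zero_t_four
  have h2 := G.lie_s_two_t_step G.act_four h0 (by simp [G.act_one.h0])
  refine ⟨h0, G.lie_s_one_t 5, h2, ?_⟩
  have h := G.chi
  simp only [r_r_f] at h
  have h1 : ⁅G.s 1, G.s 0⁆ = (1 / 4 : ℂ) • G.t 4 := by
    rw [t_add_four, t_three, lie_smul]; push_cast; module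
  simp only [← h1] at h
  have h2' : ⁅G.f, ⁅G.s 1, G.s 0⁆⁆ = ⁅G.s 2, G.s 0⁆ := by
    rw [leibniz_lie, lie_f_s, lie_f_s, lie_self, add_zero]
  have h3' : ⁅G.f, ⁅G.s 2, G.s 0⁆⁆ = ⁅G.s 3, G.s 0⁆ + ⁅G.s 2, G.s 1⁆ := by
    rw [leibniz_lie, lie_f_s, lie_f_s]
  have h4' : ⁅G.f, ⁅G.s 3, G.s 0⁆ + ⁅G.s 2, G.s 1⁆⁆ = (2 : ℂ) • ⁅G.s 3, G.s 1⁆ := by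
    simp only [lie_add, leibniz_lie G.f, lie_f_s, Nat.reduceAdd, s_four, zero_lie, lie_self]
    module
  rw [h2', h3', h4', ← h2', h1] at h
  have he : G.e = (-(1 / 2) : ℂ) • G.t 2 := by rw [t_two]; module
  rw [he] at h
  have a4 := G.act_four
  have a1 := G.act_one
  simp only [add_lie, smul_lie, lie_lie, lie_add, lie_sub, lie_smul, lie_s_lie_f, h0, h2,
    lie_s_one_t, a4.h0, a4.h2, a4.h3, a1.h0, Nat.reduceAdd, Nat.reduceSub, zero_add,
    lie_zero, zero_sub, lie_neg, sub_zero, s_four, zero_lie] at h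
  simp only [Nat.reduceAdd, Nat.reduceSub]
  push_cast at h ⊢
  linear_combination (norm := module) (-2 / 7 : ℂ) • h

/-- This is $\mathrm{ad}_f$ of `psi`. The coefficients $4,-3,2,-1$ combine to $1,-1,1,-1$ because
$s_4=0$. Every factor is now an iterated bracket of the $s_i$, and the right side is a multiple of
`p`, whose action on all `t k` is known. -/
lemma lie_f_psi :
    ⁅G.s 3, ⁅G.s 2, G.s 0⁆⁆ - (2 : ℂ) • ⁅G.s 2, ⁅G.s 2, G.s 1⁆⁆ + (2 : ℂ) • ⁅G.s 1, ⁅G.s 3, G.s 1⁆⁆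
      - (2 : ℂ) • ⁅G.s 0, ⁅G.s 3, G.s 2⁆⁆ = (15 : ℂ) • G.p := by
  have h1 : ⁅G.s 1, G.s 0⁆ = (1 / 4 : ℂ) • G.t 4 := by
    rw [t_add_four, t_three, lie_smul]; push_cast; module
  have h2' : ⁅G.f, ⁅G.s 1, G.s 0⁆⁆ = ⁅G.s 2, G.s 0⁆ := by
    rw [leibniz_lie, lie_f_s, lie_f_s, lie_self, add_zero]
  have h3' : ⁅G.f, ⁅G.s 2, G.s 0⁆⁆ = (2 : ℂ) • ⁅G.s 2, G.s 1⁆ + (1 / 2 : ℂ) • G.K := by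
    have h : ⁅G.s 0, G.s 3⁆ - ⁅G.s 1, G.s 2⁆ = (-(1 / 2) : ℂ) • G.K := G.phi
    rw [← lie_skew (G.s 0)] at h
    rw [← lie_skew (G.s 1)] at h
    rw [leibniz_lie, lie_f_s, lie_f_s]
    linear_combination (norm := module) (-1 : ℂ) • h
  have h4' : ⁅G.f, (2 : ℂ) • ⁅G.s 2, G.s 1⁆ + (1 / 2 : ℂ) • G.K⁆ = (2 : ℂ) • ⁅G.s 3, G.s 1⁆ := by
    simp only [lie_add, lie_smul, leibniz_lie G.f (G.s _), lie_f_s, lie_self, lie_K_right]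
    module
  have h5' : ⁅G.f, ⁅G.s 3, G.s 1⁆⁆ = ⁅G.s 3, G.s 2⁆ := by
    rw [leibniz_lie, lie_f_s, lie_f_s, s_four, zero_lie, zero_add]
  have key (y : L) (h : (4 : ℂ) • ⁅G.s 3, y⁆ - (3 : ℂ) • ⁅G.s 2, ⁅G.f, y⁆⁆
      + (2 : ℂ) • ⁅G.s 1, ⁅G.f, ⁅G.f, y⁆⁆⁆ - ⁅G.s 0, ⁅G.f, ⁅G.f, ⁅G.f, y⁆⁆⁆⁆ = (15 : ℂ) • G.q) :
      ⁅G.s 3, ⁅G.f, y⁆⁆ - ⁅G.s 2, ⁅G.f, ⁅G.f, y⁆⁆⁆ + ⁅G.s 1, ⁅G.f, ⁅G.f, ⁅G.f, y⁆⁆⁆⁆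
        - ⁅G.s 0, ⁅G.f, ⁅G.f, ⁅G.f, ⁅G.f, y⁆⁆⁆⁆⁆ = (15 : ℂ) • G.p := by
    have h' := congrArg (fun x => ⁅G.f, x⁆) h
    simp only [lie_add, lie_sub, lie_smul, leibniz_lie G.f (G.s _), lie_f_s, Nat.reduceAdd,
      zero_add, s_four, zero_lie, G.lie_f_q] at h'
    linear_combination (norm := module) (1 : ℂ) • h'
  have h := G.psi
  simp only [r_r_f, ← h1] at h
  have h := key _ h
  rw [h2', h3', h4', lie_smul _ G.f, h5'] at h
  simp only [lie_add, lie_smul, lie_K_right, smul_zero, add_zero] at h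
  exact h

lemma lie_s_three_t_step {n : ℕ} (a1 : G.Act (n + 1)) (a2 : G.Act (n + 2)) (a4 : G.Act (n + 4))
    (a5 : G.Act (n + 5)) (h0 : ⁅G.s 0, G.t (n + 6)⁆ = 0)
    (h2 : ⁅G.s 2, G.t (n + 6)⁆ =
      (2 * (n + 6 : ℕ) / ((n + 6 : ℕ) + 1) : ℂ) • ⁅G.f, G.t (n + 6 + 1)⁆) :
    G.Act (n + 6) := by
  refine ⟨h0, G.lie_s_one_t _, h2, ?_⟩
  have n2 : (n + 2 : ℂ) ≠ 0 := by exact_mod_cast (by omega : n + 2 ≠ 0)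
  have n1 : (n + 1 : ℂ) ≠ 0 := by exact_mod_cast (by omega : n + 1 ≠ 0)
  have n5 : (n + 5 : ℂ) ≠ 0 := by exact_mod_cast (by omega : n + 5 ≠ 0)
  have n6 : (n + 6 : ℂ) ≠ 0 := by exact_mod_cast (by omega : n + 6 ≠ 0)
  have n7 : (n + 7 : ℂ) ≠ 0 := by exact_mod_cast (by omega : n + 7 ≠ 0)
  have n8 : (n + 8 : ℂ) ≠ 0 := by exact_mod_cast (by omega : n + 8 ≠ 0)
  have h := congrArg (fun x => ⁅x, G.t (n + 4)⁆) G.lie_f_psi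
  simp only [add_lie, sub_lie, smul_lie, lie_lie, lie_add, lie_sub, lie_smul, lie_s_lie_f, h0, h2,
    lie_s_one_t, a4.h0, a4.h2, a4.h3, a1.h0, a1.h2, a2.h0, a5.h0, a5.h2, a5.h3,
    Nat.reduceAdd, Nat.reduceSubDiff, add_assoc, zero_add, lie_p_t,
    lie_zero, zero_sub, lie_neg, sub_zero, s_four, zero_lie] at h
  simp only [add_assoc, Nat.reduceAdd, Nat.reduceSubDiff]
  push_cast at h ⊢
  -- Up to sign, $[s_3,t_{n+6}]$ occurs in `h` with coefficient $(n+1)(n+7)(n+8)/(2(n+5))$. The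
  -- factor $n+1$ would vanish at index 5, the case settled by `chi`.
  linear_combination (norm := skip) (-(2 * (n + 5)) / ((n + 1) * (n + 7) * (n + 8)) : ℂ) • h
  have e5 : (n + 4 + 1 : ℂ) = n + 5 := by ring
  have e6 : (n + 5 + 1 : ℂ) = n + 6 := by ring
  have e7 : (n + 6 + 1 : ℂ) = n + 7 := by ring
  have e2 : (n + 1 + 1 : ℂ) = n + 2 := by ring
  rw [e2, e5, e6, e7]
  match_scalars <;> field_simp <;> ring

lemma act (k : ℕ) : G.Act k := by
  induction k using Nat.strong_induction_on with
  | _ k ih =>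
    match k, ih with
    | 0, _ => exact G.act_zero
    | 1, _ => exact G.act_one
    | 2, _ => exact G.act_two
    | 3, _ => exact G.act_three
    | 4, _ => exact G.act_four
    | 5, _ => exact G.act_five
    | n + 6, ih =>
      have h0 := G.lie_s_zero_t_step (k := n + 1) (ih 3 (by omega)) (ih (n + 4) (by omega))
        (ih (n + 5) (by omega)).h0
      exact G.lie_s_three_t_step (ih _ (by omega)) (ih _ (by omega)) (ih _ (by omega))
        (ih _ (by omega)) h0 (G.lie_s_two_t_step (ih _ (by omega)) h0
          (G.lie_s_zero_t_sub (ih _ (by omega)).h0))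

lemma lie_q_t (k : ℕ) : ⁅G.q, G.t k⁆ = 0 := by
  match k with
  | 0 => exact G.lie_K_right _
  | 1 => exact lie_self _
  | 2 =>
    have h : ⁅G.e, G.t 1⁆ = 0 := G.lie_e_t fun j _ => (G.act j).h0
    rw [t_two, lie_smul, ← lie_skew, ← t_one, h, neg_zero, smul_zero]
  | 3 => rw [t_three, lie_smul, ← lie_skew, s_zero, G.lie_r_q, neg_zero, smul_zero]
  | n + 4 =>
    have h : ⁅G.q, G.s 1⁆ = G.e := by rw [← lie_skew, lie_s_one_q, neg_neg]
    rw [t_add_four, lie_smul, leibniz_lie, h, lie_q_t (n + 3),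
      G.lie_e_t fun j _ => (G.act j).h0, lie_zero, add_zero, smul_zero]

/-! ### Nilpotency of $\mathrm{ad}_f$ and the elements `b (i, j)` -/

/-- The iterates of `ad f` on `t k`. -/
noncomputable def w (j k : ℕ) : L := (LieAlgebra.ad ℂ L G.f ^ j) (G.t k)

lemma ad_f_pow_succ (n : ℕ) (x : L) :
    (LieAlgebra.ad ℂ L G.f ^ (n + 1)) x = ⁅G.f, (LieAlgebra.ad ℂ L G.f ^ n) x⁆ := by
  rw [pow_succ', Module.End.mul_apply, LieAlgebra.ad_apply]

lemma ad_f_pow_lie (n : ℕ) (x : L) :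
    (LieAlgebra.ad ℂ L G.f ^ n) ⁅G.f, x⁆ = (LieAlgebra.ad ℂ L G.f ^ (n + 1)) x := by
  rw [pow_succ, Module.End.mul_apply, LieAlgebra.ad_apply]

lemma w_zero (k : ℕ) : G.w 0 k = G.t k := rfl

lemma w_succ (j k : ℕ) : G.w (j + 1) k = ⁅G.f, G.w j k⁆ := G.ad_f_pow_succ j _

lemma ad_f_pow_lie_s_two (n : ℕ) (x : L) :
    (LieAlgebra.ad ℂ L G.f ^ (n + 1)) ⁅G.s 2, x⁆ =
      ⁅G.s 2, (LieAlgebra.ad ℂ L G.f ^ (n + 1)) x⁆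
        + (n + 1 : ℂ) • ⁅G.s 3, (LieAlgebra.ad ℂ L G.f ^ n) x⁆ := by
  induction n with
  | zero => simp [leibniz_lie G.f, lie_f_s]; abel
  | succ n ih =>
    rw [ad_f_pow_succ, ih]
    simp only [lie_add, lie_smul, leibniz_lie G.f (G.s _), lie_f_s, Nat.reduceAdd, s_four, zero_lie,
      ad_f_pow_succ]
    push_cast
    module

lemma ad_f_pow_lie_s_one (n : ℕ) (x : L) :
    (LieAlgebra.ad ℂ L G.f ^ (n + 2)) ⁅G.s 1, x⁆ =
      ⁅G.s 1, (LieAlgebra.ad ℂ L G.f ^ (n + 2)) x⁆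
        + (n + 2 : ℂ) • ⁅G.s 2, (LieAlgebra.ad ℂ L G.f ^ (n + 1)) x⁆
        + ((n + 2) * (n + 1) / 2 : ℂ) • ⁅G.s 3, (LieAlgebra.ad ℂ L G.f ^ n) x⁆ := by
  induction n with
  | zero =>
    simp only [leibniz_lie G.f (G.s _), lie_f_s, Nat.reduceAdd, zero_add, ad_f_pow_succ, pow_zero,
      Module.End.one_apply, lie_add, CharP.cast_eq_zero]
    module
  | succ n ih =>
    rw [show n + 1 + 2 = n + 2 + 1 by rfl, ad_f_pow_succ, ih]
    simp only [lie_add, lie_smul, leibniz_lie G.f (G.s _), lie_f_s, Nat.reduceAdd, s_four, zero_lie,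
      ad_f_pow_succ]
    push_cast
    module

/-- Expanding $\mathrm{ad}_f^{k+2}[s_1,t_k]$ and $\mathrm{ad}_f^{k+1}[s_2,t_k]$ by Leibniz gives two
equations in the same unknowns `Y` and `Z`. Eliminating `Y` leaves a multiple of `Z` that is nonzero
once `k > 0`. -/
lemma w_succ_self (k : ℕ) : G.w (k + 1) k = 0 := by
  induction k with
  | zero => simp [w_succ, w_zero, t_zero, lie_K_right]
  | succ k ih =>
    rcases Nat.eq_zero_or_pos k with rfl | hk
    · simp [w_succ, w_zero, t_one, G.lie_f_q, lie_f_p]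
    · have hk' : (k : ℂ) ≠ 0 := by exact_mod_cast hk.ne'
      have k1 : (k + 1 : ℂ) ≠ 0 := by exact_mod_cast (by omega : k + 1 ≠ 0)
      have k3 : (k + 3 : ℂ) ≠ 0 := by exact_mod_cast (by omega : k + 3 ≠ 0)
      have ih1 : (LieAlgebra.ad ℂ L G.f ^ (k + 1)) (G.t k) = 0 := ih
      have e1 := G.ad_f_pow_lie_s_one k (G.t k)
      have e2 := G.ad_f_pow_lie_s_two k (G.t k)
      have ih2 : (LieAlgebra.ad ℂ L G.f ^ (k + 2)) (G.t k) = 0 := by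
        rw [ad_f_pow_succ, ih1, lie_zero]
      rw [ih2, ih1, (G.act k).h1, map_smul] at e1
      rw [ih1, (G.act k).h2, map_smul, ad_f_pow_lie] at e2
      simp only [lie_zero, smul_zero, zero_add] at e1 e2
      change _ = 0
      unfold w
      set Y := ⁅G.s 3, (LieAlgebra.ad ℂ L G.f ^ k) (G.t k)⁆
      set Z := (LieAlgebra.ad ℂ L G.f ^ (k + 2)) (G.t (k + 1))
      have : (k * (k + 3) / (k + 1) : ℂ) • Z = 0 := by
        linear_combination (norm := skip) (k + 2 : ℂ) • e2 + (-2 : ℂ) • e1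
        match_scalars <;> field_simp <;> ring
      exact (smul_eq_zero.1 this).resolve_left (div_ne_zero (mul_ne_zero hk' k3) k1)

lemma w_eq_zero {j k : ℕ} (h : k < j) : G.w j k = 0 := by
  induction j, h using Nat.le_induction with
  | base => exact G.w_succ_self k
  | succ j _ ih => rw [w_succ, ih, lie_zero]

/-- The element corresponding, up to a scalar, to the symmetrization of `x ^ a ∂ ^ b`. -/
noncomputable def b (i : ℕ × ℕ) : L := G.w i.2 (i.1 + i.2)

lemma lie_p_w (j k : ℕ) : ⁅G.p, G.w j k⁆ = (k : ℂ) • G.w j (k - 1) := by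
  induction j with
  | zero => exact G.lie_p_t k
  | succ j ih => rw [w_succ, leibniz_lie, G.lie_p_f, zero_lie, zero_add, ih, lie_smul, w_succ]

lemma lie_q_w_zero (k : ℕ) : ⁅G.q, G.w 0 k⁆ = 0 := G.lie_q_t k

lemma lie_q_w_succ (j k : ℕ) : ⁅G.q, G.w (j + 1) k⁆ = (-((j + 1) * k) : ℂ) • G.w j (k - 1) := by
  have h : ⁅G.q, G.f⁆ = -G.p := by rw [← lie_skew, G.lie_f_q]
  induction j with
  | zero =>
    rw [w_succ, leibniz_lie, h, lie_q_w_zero, lie_zero, neg_lie, lie_p_w]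
    push_cast
    module
  | succ j ih =>
    rw [w_succ, leibniz_lie, h, ih, lie_smul, ← w_succ, neg_lie, lie_p_w]
    push_cast
    module

lemma lie_p_b_succ (a b : ℕ) : ⁅G.p, G.b (a + 1, b)⁆ = (a + b + 1 : ℂ) • G.b (a, b) := by
  unfold DiffOpTuple.b
  rw [lie_p_w, show a + 1 + b - 1 = a + b by omega]
  push_cast
  module

lemma lie_p_b_zero (b : ℕ) : ⁅G.p, G.b (0, b)⁆ = 0 := by
  unfold DiffOpTuple.b
  rw [lie_p_w]
  rcases Nat.eq_zero_or_pos b with rfl | hb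
  · simp
  · rw [w_eq_zero _ (by dsimp only; omega), smul_zero]

lemma lie_q_b_succ (a b : ℕ) :
    ⁅G.q, G.b (a, b + 1)⁆ = (-((b + 1) * (a + b + 1)) : ℂ) • G.b (a, b) := by
  unfold DiffOpTuple.b
  rw [lie_q_w_succ, show a + (b + 1) - 1 = a + b by omega]
  push_cast
  module

lemma lie_q_b_zero (a : ℕ) : ⁅G.q, G.b (a, 0)⁆ = 0 := G.lie_q_w_zero _

lemma ad_p_pow_b_eq_zero (a c d : ℕ) (h : c < a) : (LieAlgebra.ad ℂ L G.p ^ a) (G.b (c, d)) = 0 := by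
  induction c generalizing a with
  | zero =>
    obtain ⟨a, rfl⟩ := Nat.exists_eq_succ_of_ne_zero h.ne'
    rw [pow_succ, Module.End.mul_apply, LieAlgebra.ad_apply, lie_p_b_zero, map_zero]
  | succ c ih =>
    obtain ⟨a, rfl⟩ := Nat.exists_eq_succ_of_ne_zero (by omega : a ≠ 0)
    rw [pow_succ, Module.End.mul_apply, LieAlgebra.ad_apply, lie_p_b_succ, map_smul,
      ih a (by omega), smul_zero]

lemma ad_q_pow_b_eq_zero (b c d : ℕ) (h : d < b) : (LieAlgebra.ad ℂ L G.q ^ b) (G.b (c, d)) = 0 := by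
  induction d generalizing b with
  | zero =>
    obtain ⟨b, rfl⟩ := Nat.exists_eq_succ_of_ne_zero h.ne'
    rw [pow_succ, Module.End.mul_apply, LieAlgebra.ad_apply, lie_q_b_zero, map_zero]
  | succ d ih =>
    obtain ⟨b, rfl⟩ := Nat.exists_eq_succ_of_ne_zero (by omega : b ≠ 0)
    rw [pow_succ, Module.End.mul_apply, LieAlgebra.ad_apply, lie_q_b_succ, map_smul,
      ih b (by omega), smul_zero]

lemma ad_p_pow_b (a d : ℕ) :
    ∃ z : ℂ, z ≠ 0 ∧ (LieAlgebra.ad ℂ L G.p ^ a) (G.b (a, d)) = z • G.b (0, d) := by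
  induction a with
  | zero => exact ⟨1, one_ne_zero, by simp⟩
  | succ a ih =>
    obtain ⟨z, hz, h⟩ := ih
    refine ⟨(a + d + 1) * z, mul_ne_zero (by exact_mod_cast (by omega : a + d + 1 ≠ 0)) hz, ?_⟩
    rw [pow_succ, Module.End.mul_apply, LieAlgebra.ad_apply, lie_p_b_succ, map_smul, h, smul_smul]

lemma ad_q_pow_b (b c d : ℕ) :
    ∃ z : ℂ, z ≠ 0 ∧ (LieAlgebra.ad ℂ L G.q ^ b) (G.b (c, d + b)) = z • G.b (c, d) := by
  induction b with
  | zero => exact ⟨1, one_ne_zero, by simp⟩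
  | succ b ih =>
    obtain ⟨z, hz, h⟩ := ih
    refine ⟨-(((d + b : ℕ) + 1) * (c + (d + b : ℕ) + 1)) * z,
      mul_ne_zero (neg_ne_zero.2 (mul_ne_zero ?_ ?_)) hz, ?_⟩
    · exact_mod_cast (by omega : d + b + 1 ≠ 0)
    · exact_mod_cast (by omega : c + (d + b) + 1 ≠ 0)
    · rw [pow_succ, Module.End.mul_apply, LieAlgebra.ad_apply, ← add_assoc, lie_q_b_succ, map_smul,
        h, smul_smul]

/-! ### The span `M` contains the generated Lie subalgebra -/

/-- The span of the elements `b (i, j)`. -/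
noncomputable def M : Submodule ℂ L := Submodule.span ℂ (Set.range G.b)

/-- A nonzero subspace of `M` stable under `ad p` and `ad q` contains `K`. -/
lemma K_mem_of_mem_M {I : Submodule ℂ L} (hp : ∀ x ∈ I, ⁅G.p, x⁆ ∈ I) (hq : ∀ x ∈ I, ⁅G.q, x⁆ ∈ I)
    {m : L} (hm : m ∈ G.M) (hmI : m ∈ I) (h0 : m ≠ 0) : G.K ∈ I := by
  obtain ⟨c, rfl⟩ := Finsupp.mem_span_range_iff_exists_finsupp.1 hm
  have hc : c.support.Nonempty := by
    rw [Finsupp.support_nonempty_iff]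
    rintro rfl
    simp at h0
  -- For `(a, b)` of maximal total degree in the support, $\mathrm{ad}_p^a\,\mathrm{ad}_q^b$ sends
  -- its term to a nonzero multiple of `b (0, 0)`, which is `K`. Any other term has first index
  -- below `a` or second below `b`, and is killed.
  obtain ⟨⟨a, b⟩, hab, hmax⟩ := c.support.exists_max_image (fun i => i.1 + i.2) hc
  have hI : ∀ (n : ℕ) (y : L), (∀ x ∈ I, ⁅y, x⁆ ∈ I) → ∀ x ∈ I, (LieAlgebra.ad ℂ L y ^ n) x ∈ I := by
    intro n y hy x hx
    induction n with
    | zero => simpa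
    | succ n ih => rw [pow_succ', Module.End.mul_apply, LieAlgebra.ad_apply]; exact hy _ ih
  have h := hI a _ hp _ (hI b _ hq _ hmI)
  obtain ⟨z, hz, e1⟩ := G.ad_q_pow_b b a 0
  obtain ⟨z', hz', e2⟩ := G.ad_p_pow_b a 0
  rw [zero_add] at e1
  rw [Finsupp.sum, map_sum, map_sum, Finset.sum_eq_single (a, b)] at h
  · simp only [map_smul, e1, e2] at h
    rw [I.smul_mem_iff (Finsupp.mem_support_iff.1 hab), I.smul_mem_iff hz, I.smul_mem_iff hz'] at h
    exact h
  · rintro ⟨c', d⟩ hcd hne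
    have h1 := hmax _ hcd
    dsimp only at h1
    rw [map_smul, map_smul]
    rcases lt_or_ge d b with hd | hd
    · rw [ad_q_pow_b_eq_zero _ _ _ _ hd, map_zero, smul_zero]
    · obtain ⟨d, rfl⟩ := Nat.exists_eq_add_of_le' hd
      obtain ⟨z, -, e⟩ := G.ad_q_pow_b b c' d
      rw [e, map_smul, ad_p_pow_b_eq_zero, smul_zero, smul_zero]
      rcases Nat.lt_or_ge c' a with h2 | h2
      · exact h2
      · exact absurd (Prod.ext (by dsimp only; omega) (by dsimp only; omega)) hne
  · exact fun h => absurd hab h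

lemma w_mem_M (j k : ℕ) : G.w j k ∈ G.M := by
  rcases lt_or_ge k j with h | h
  · rw [w_eq_zero _ h]; exact zero_mem _
  · exact Submodule.subset_span ⟨(k - j, j), by unfold DiffOpTuple.b; dsimp only; congr; omega⟩

lemma M_induction {P : L → Prop} (hw : ∀ j k, P (G.w j k)) (h0 : P 0)
    (ha : ∀ x y, P x → P y → P (x + y)) (hs : ∀ (z : ℂ) x, P x → P (z • x)) {m : L}
    (hm : m ∈ G.M) : P m :=
  Submodule.span_induction (p := fun x _ => P x) (by rintro _ ⟨i, rfl⟩; exact hw _ _) h0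
    (fun x y _ _ => ha x y) (fun z x _ => hs z x) hm

lemma lie_f_mem_M {m : L} (hm : m ∈ G.M) : ⁅G.f, m⁆ ∈ G.M := by
  refine G.M_induction (P := fun m => ⁅G.f, m⁆ ∈ G.M) (fun j k => ?_) ?_ ?_ ?_ hm
  · rw [← w_succ]; exact G.w_mem_M _ _
  · simp
  · intro x y hx hy; rw [lie_add]; exact add_mem hx hy
  · intro z x hx; rw [lie_smul]; exact Submodule.smul_mem _ _ hx

lemma lie_mem_M_of_w {v : L} (h : ∀ j k, ⁅v, G.w j k⁆ ∈ G.M) {m : L} (hm : m ∈ G.M) :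
    ⁅v, m⁆ ∈ G.M := by
  refine G.M_induction (P := fun m => ⁅v, m⁆ ∈ G.M) h ?_ ?_ ?_ hm
  · simp
  · intro x y hx hy; rw [lie_add]; exact add_mem hx hy
  · intro z x hx; rw [lie_smul]; exact Submodule.smul_mem _ _ hx

lemma lie_s_mem_M (i : ℕ) {m : L} (hm : m ∈ G.M) : ⁅G.s i, m⁆ ∈ G.M := by
  refine G.lie_mem_M_of_w (fun j k => ?_) hm
  induction j generalizing i with
  | zero =>
    have a := G.act k
    rw [w_zero]
    match i with
    | 0 => rw [a.h0]; exact zero_mem _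
    | 1 => rw [a.h1]; exact Submodule.smul_mem _ _ (G.w_mem_M 0 _)
    | 2 => rw [a.h2]; exact Submodule.smul_mem _ _ (G.w_mem_M 1 _)
    | 3 =>
      rw [a.h3]
      exact add_mem (Submodule.smul_mem _ _ (G.w_mem_M 2 _)) (Submodule.smul_mem _ _ (G.w_mem_M 0 _))
    | n + 4 =>
      have : ∀ n, G.s (n + 4) = 0 := by
        intro n
        induction n with
        | zero => exact G.s_four
        | succ n ih => rw [show n + 1 + 4 = n + 4 + 1 by rfl, ← lie_f_s, ih, lie_zero]
      rw [this, zero_lie]; exact zero_mem _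
  | succ j ih =>
    rw [w_succ, lie_s_lie_f]
    exact sub_mem (G.lie_f_mem_M (ih i)) (ih (i + 1))

lemma lie_q_mem_M {m : L} (hm : m ∈ G.M) : ⁅G.q, m⁆ ∈ G.M := by
  refine G.lie_mem_M_of_w (fun j k => ?_) hm
  match j with
  | 0 => rw [lie_q_w_zero]; exact zero_mem _
  | j + 1 => rw [lie_q_w_succ]; exact Submodule.smul_mem _ _ (G.w_mem_M _ _)

/-- The Lie subalgebra generated by `q`, `f` and `r`. -/
def sub : LieSubalgebra ℂ L := LieSubalgebra.lieSpan ℂ L {G.q, G.f, G.r}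

/-- The elements of `M` whose adjoint action preserves `M`. -/
def stab : LieSubalgebra ℂ L where
  carrier := {v | v ∈ G.M ∧ ∀ m ∈ G.M, ⁅v, m⁆ ∈ G.M}
  add_mem' := fun hx hy => ⟨add_mem hx.1 hy.1, fun m hm => by
    rw [add_lie]; exact add_mem (hx.2 m hm) (hy.2 m hm)⟩
  zero_mem' := ⟨zero_mem _, fun m _ => by rw [zero_lie]; exact zero_mem _⟩
  smul_mem' := fun z _ hx => ⟨Submodule.smul_mem _ _ hx.1, fun m hm => by
    rw [smul_lie]; exact Submodule.smul_mem _ _ (hx.2 m hm)⟩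
  lie_mem' := fun hx hy => ⟨hx.2 _ hy.1, fun m hm => by
    rw [lie_lie]; exact sub_mem (hx.2 _ (hy.2 _ hm)) (hy.2 _ (hx.2 _ hm))⟩

/-- `stab` is closed under brackets, although `M` is not known to be, so it is enough to place the
three generators in it. -/
lemma sub_le_M {x : L} (hx : x ∈ G.sub) : x ∈ G.M := by
  have h : G.sub ≤ G.stab := by
    refine LieSubalgebra.lieSpan_le.2 ?_
    rintro _ (rfl | rfl | rfl)
    · exact ⟨G.w_mem_M 0 1, fun m hm => G.lie_q_mem_M hm⟩
    · refine ⟨?_, fun m hm => G.lie_f_mem_M hm⟩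
      have h := G.w_mem_M 2 2
      rw [w_succ, w_succ, w_zero, t_two, lie_smul, lie_smul, lie_f_f_e, smul_smul] at h
      rwa [G.M.smul_mem_iff (by norm_num)] at h
    · refine ⟨?_, fun m hm => G.lie_s_mem_M 0 hm⟩
      have h := G.w_mem_M 0 3
      rwa [w_zero, t_three, G.M.smul_mem_iff (by norm_num)] at h
  exact (h hx).1

lemma q_mem_sub : G.q ∈ G.sub := LieSubalgebra.subset_lieSpan (by simp)
lemma f_mem_sub : G.f ∈ G.sub := LieSubalgebra.subset_lieSpan (by simp)
lemma r_mem_sub : G.r ∈ G.sub := LieSubalgebra.subset_lieSpan (by simp)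
lemma p_mem_sub : G.p ∈ G.sub := G.lie_f_q ▸ G.sub.lie_mem G.f_mem_sub G.q_mem_sub
lemma K_mem_sub : G.K ∈ G.sub := G.lie_p_q ▸ G.sub.lie_mem G.p_mem_sub G.q_mem_sub
lemma e_mem_sub : G.e ∈ G.sub := G.lie_r_p ▸ G.sub.lie_mem G.r_mem_sub G.p_mem_sub

/-- A Lie algebra map that does not kill `K` is injective on the subalgebra generated by the
tuple. -/
lemma eq_zero_of_map_eq_zero {L' : Type*} [LieRing L'] [LieAlgebra ℂ L'] (θ : L →ₗ⁅ℂ⁆ L')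
    (hK : θ G.K ≠ 0) {x : L} (hx : x ∈ G.sub) (h : θ x = 0) : x = 0 := by
  by_contra h0
  refine hK (G.K_mem_of_mem_M (I := LinearMap.ker (θ : L →ₗ[ℂ] L')) ?_ ?_ (G.sub_le_M hx) h h0)
  all_goals
    intro y hy
    rw [LinearMap.mem_ker, LieHom.coe_toLinearMap] at hy ⊢
    rw [LieHom.map_lie, hy, lie_zero]

end DiffOpTuple

/-! ### The relations hold for $x$ and $\partial$ -/

section Weyl

variable {B : Type*} [Ring B] [Algebra ℂ B] {x d : B}

lemma weyl_normal {B : Type*} [Ring B] {x d : B} (h : d * x = x * d + 1) (w : B) : d * (x * w) = x * (d * w) + w := by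
  rw [← mul_assoc, h, add_mul, one_mul, mul_assoc]

/-- Normally ordered forms of brackets of differential operators. -/
lemma weyl_brackets (h : d * x = x * d + 1) :
    ⁅(1 / 2 : ℂ) • d ^ 2, (1 / 6 : ℂ) • x ^ 3⁆ = (1 / 2 : ℂ) • (x ^ 2 * d + x) ∧
    ⁅(1 / 2 : ℂ) • d ^ 2, (1 / 2 : ℂ) • (x ^ 2 * d + x)⁆ = x * d ^ 2 + d ∧
    ⁅(1 / 2 : ℂ) • d ^ 2, x * d ^ 2 + d⁆ = d ^ 3 ∧
    ⁅(1 / 2 : ℂ) • d ^ 2, d ^ 3⁆ = 0 ∧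
    ⁅(1 / 6 : ℂ) • x ^ 3, (1 / 2 : ℂ) • d ^ 2⁆ = -(1 / 2 : ℂ) • (x ^ 2 * d + x) ∧
    ⁅(1 / 6 : ℂ) • x ^ 3, -(1 / 2 : ℂ) • (x ^ 2 * d + x)⁆ = (1 / 4 : ℂ) • x ^ 4 ∧
    ⁅(1 / 6 : ℂ) • x ^ 3, (1 / 4 : ℂ) • x ^ 4⁆ = 0 ∧
    ⁅(1 / 2 : ℂ) • d ^ 2, (1 / 4 : ℂ) • x ^ 4⁆ = x ^ 3 * d + (3 / 2 : ℂ) • x ^ 2 ∧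
    ⁅(1 / 2 : ℂ) • d ^ 2, x ^ 3 * d + (3 / 2 : ℂ) • x ^ 2⁆ =
      (3 : ℂ) • (x ^ 2 * d ^ 2) + (6 : ℂ) • (x * d) + (3 / 2 : ℂ) • 1 ∧
    ⁅(1 / 2 : ℂ) • d ^ 2,
      (3 : ℂ) • (x ^ 2 * d ^ 2) + (6 : ℂ) • (x * d) + (3 / 2 : ℂ) • (1 : B)⁆ =
      (6 : ℂ) • (x * d ^ 3) + (9 : ℂ) • d ^ 2 := by
  refine ⟨?_, ?_, ?_, ?_, ?_, ?_, ?_, ?_, ?_, ?_⟩ <;>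
  · simp only [Ring.lie_def, pow_succ, pow_zero, one_mul, mul_one, mul_add, add_mul,
      smul_mul_assoc, mul_smul_comm, mul_assoc, h, weyl_normal h, smul_add]
    module

set_option linter.unusedSimpArgs false in
/-- A pair of elements with `[d, x] = 1` gives a tuple of generators. -/
noncomputable def DiffOpTuple.ofWeyl (h : d * x = x * d + 1) : DiffOpTuple B where
  K := 1
  q := x
  p := d
  e := -((1 / 2 : ℂ) • x ^ 2)
  f := (1 / 2 : ℂ) • d ^ 2
  r := (1 / 6 : ℂ) • x ^ 3
  lie_K x := by rw [Ring.lie_def, one_mul, mul_one, sub_self]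
  lie_f_f_f_f_r := by
    obtain ⟨h1, h2, h3, h4, -⟩ := weyl_brackets h
    rw [h1, h2, h3, h4]
  lie_r_r_r_f := by
    obtain ⟨-, -, -, -, h5, h6, h7, -⟩ := weyl_brackets h
    rw [h5, h6, h7]
  lie_p_q := by
    simp only [Ring.lie_def, pow_succ, pow_zero, one_mul, mul_one, mul_add, add_mul, mul_neg,
      neg_mul, mul_sub, sub_mul, smul_mul_assoc, mul_smul_comm, mul_assoc, h, weyl_normal h,
      smul_add, smul_sub,
      smul_neg]
    module
  lie_f_q := by
    simp only [Ring.lie_def, pow_succ, pow_zero, one_mul, mul_one, mul_add, add_mul, mul_neg,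
      neg_mul, mul_sub, sub_mul, smul_mul_assoc, mul_smul_comm, mul_assoc, h, weyl_normal h,
      smul_add, smul_sub,
      smul_neg]
    module
  lie_p_f := by
    simp only [Ring.lie_def, pow_succ, pow_zero, one_mul, mul_one, mul_add, add_mul, mul_neg,
      neg_mul, mul_sub, sub_mul, smul_mul_assoc, mul_smul_comm, mul_assoc, h, weyl_normal h,
      smul_add, smul_sub,
      smul_neg]
    module
  lie_e_p := by
    simp only [Ring.lie_def, pow_succ, pow_zero, one_mul, mul_one, mul_add, add_mul, mul_neg,
      neg_mul, mul_sub, sub_mul, smul_mul_assoc, mul_smul_comm, mul_assoc, h, weyl_normal h,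
      smul_add, smul_sub,
      smul_neg]
    module
  lie_f_e_f := by
    simp only [Ring.lie_def, pow_succ, pow_zero, one_mul, mul_one, mul_add, add_mul, mul_neg,
      neg_mul, mul_sub, sub_mul, smul_mul_assoc, mul_smul_comm, mul_assoc, h, weyl_normal h,
      smul_add, smul_sub,
      smul_neg]
    module
  lie_r_p := by
    simp only [Ring.lie_def, pow_succ, pow_zero, one_mul, mul_one, mul_add, add_mul, mul_neg,
      neg_mul, mul_sub, sub_mul, smul_mul_assoc, mul_smul_comm, mul_assoc, h, weyl_normal h,
      smul_add, smul_sub,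
      smul_neg]
    module
  lie_e_r := by
    simp only [Ring.lie_def, pow_succ, pow_zero, one_mul, mul_one, mul_add, add_mul, mul_neg,
      neg_mul, mul_sub, sub_mul, smul_mul_assoc, mul_smul_comm, mul_assoc, h, weyl_normal h,
      smul_add, smul_sub,
      smul_neg]
    module
  lie_e_f_r := by
    rw [(weyl_brackets h).1]
    simp only [Ring.lie_def, pow_succ, pow_zero, one_mul, mul_one, mul_add, add_mul, mul_neg,
      neg_mul, mul_sub, sub_mul, smul_mul_assoc, mul_smul_comm, mul_assoc, h, weyl_normal h,
      smul_add, smul_sub,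
      smul_neg]
    module
  phi := by
    obtain ⟨h1, h2, h3, -⟩ := weyl_brackets h
    rw [h1, h2, h3]
    simp only [Ring.lie_def, pow_succ, pow_zero, one_mul, mul_one, mul_add, add_mul, mul_neg,
      neg_mul, mul_sub, sub_mul, smul_mul_assoc, mul_smul_comm, mul_assoc, h, weyl_normal h,
      smul_add, smul_sub,
      smul_neg]
    module
  psi := by
    obtain ⟨h1, h2, h3, -, h5, h6, -, h8, h9, h10⟩ := weyl_brackets h
    simp only [h1, h2, h3, h5, h6, h8, h9, h10]
    simp only [Ring.lie_def, pow_succ, pow_zero, one_mul, mul_one, mul_add, add_mul, mul_neg,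
      neg_mul, mul_sub, sub_mul, smul_mul_assoc, mul_smul_comm, mul_assoc, h, weyl_normal h,
      smul_add, smul_sub,
      smul_neg]
    module
  chi := by
    obtain ⟨-, -, -, -, h5, h6, -, h8, h9, h10⟩ := weyl_brackets h
    simp only [h5, h6, h8, h9, h10]
    simp only [Ring.lie_def, pow_succ, pow_zero, one_mul, mul_one, mul_add, add_mul, mul_neg,
      neg_mul, mul_sub, sub_mul, smul_mul_assoc, mul_smul_comm, mul_assoc, h, weyl_normal h,
      smul_add, smul_sub,
      smul_neg]
    module

end Weyl

/-- The image of a tuple of generators under a Lie algebra map. -/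
def DiffOpTuple.map {L L' : Type*} [LieRing L] [LieAlgebra ℂ L] [LieRing L'] [LieAlgebra ℂ L']
    (G : DiffOpTuple L) (θ : L →ₗ⁅ℂ⁆ L') (hK : ∀ x : L', ⁅θ G.K, x⁆ = 0) : DiffOpTuple L' where
  K := θ G.K
  q := θ G.q
  p := θ G.p
  e := θ G.e
  f := θ G.f
  r := θ G.r
  lie_K := hK
  lie_p_q := by rw [← LieHom.map_lie, G.lie_p_q]
  lie_f_q := by rw [← LieHom.map_lie, G.lie_f_q]
  lie_p_f := by rw [← LieHom.map_lie, G.lie_p_f, map_zero]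
  lie_e_p := by rw [← LieHom.map_lie, G.lie_e_p]
  lie_f_e_f := by simpa only [LieHom.map_lie, map_smul, map_sub] using congrArg θ G.lie_f_e_f
  lie_r_p := by rw [← LieHom.map_lie, G.lie_r_p]
  lie_e_r := by rw [← LieHom.map_lie, G.lie_e_r, map_zero]
  lie_f_f_f_f_r := by simp only [← LieHom.map_lie, G.lie_f_f_f_f_r, map_zero]
  lie_e_f_r := by simpa only [LieHom.map_lie, map_smul, map_sub] using congrArg θ G.lie_e_f_r
  phi := by simpa only [LieHom.map_lie, map_smul, map_sub] using congrArg θ G.phi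
  lie_r_r_r_f := by simp only [← LieHom.map_lie, G.lie_r_r_r_f, map_zero]
  psi := by simpa only [LieHom.map_lie, map_smul, map_sub, map_add] using congrArg θ G.psi
  chi := by simpa only [LieHom.map_lie, map_smul, map_sub] using congrArg θ G.chi

/-! ### Tuples and algebra maps out of $A_{1,0}$ -/

namespace DDCA

lemma algHom_map_lie {B C : Type*} [Ring B] [Algebra ℂ B] [Ring C] [Algebra ℂ C] (φ : B →ₐ[ℂ] C)
    (x y : B) : φ ⁅x, y⁆ = ⁅φ x, φ y⁆ := by
  rw [Ring.lie_def, Ring.lie_def, map_sub, map_mul, map_mul]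

section

variable {B : Type*} [Ring B] [Algebra ℂ B] (G : DiffOpTuple B)

/-- The entries of a tuple. -/
def genVal : Gen → B
  | .K => G.K
  | .q => G.q
  | .p => G.p
  | .e => G.e
  | .f => G.f
  | .r => G.r

lemma lift_rel {a b : FreeA} (h : Rel 1 0 a b) :
    FreeAlgebra.lift ℂ (genVal G) a = FreeAlgebra.lift ℂ (genVal G) b := by
  have h2 : (2 : B) = (2 : ℂ) • 1 := by rw [Algebra.smul_def, map_ofNat, mul_one]
  have h3 : (3 : B) = (3 : ℂ) • 1 := by rw [Algebra.smul_def, map_ofNat, mul_one]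
  have h4 : (4 : B) = (4 : ℂ) • 1 := by rw [Algebra.smul_def, map_ofNat, mul_one]
  have h15 : (15 : B) = (15 : ℂ) • 1 := by rw [Algebra.smul_def, map_ofNat, mul_one]
  have h30 : (30 : B) = (30 : ℂ) • 1 := by rw [Algebra.smul_def, map_ofNat, mul_one]
  cases h <;>
    simp only [g, genVal, adPow, phiElt, algHom_map_lie, FreeAlgebra.lift_ι_apply, map_sub, map_add,
      map_mul, map_neg, map_smul, map_ofNat, map_zero, map_one, mul_one, zero_mul, mul_zero,
      add_zero, one_mul, Function.iterate_succ, Function.iterate_zero, Function.comp_apply, id_eq,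
      h2, h3, h4, h15, h30, smul_mul_assoc, G.lie_K, G.lie_p_q, G.lie_f_q, G.lie_p_f, G.lie_e_p,
      G.lie_f_e_f, G.lie_r_p, G.lie_e_r, G.lie_e_f_r, G.lie_f_f_f_f_r, G.lie_r_r_r_f, G.phi,
      G.psi, G.chi, neg_smul, smul_smul]
  all_goals norm_num

/-- The algebra map out of `A_{1,0}` given by a tuple. -/
def liftA : AlgA 1 0 →ₐ[ℂ] B :=
  RingQuot.liftAlgHom ℂ ⟨FreeAlgebra.lift ℂ (genVal G), fun _ _ h => lift_rel G h⟩

lemma liftA_gen (i : Gen) : liftA G (AlgA.gen 1 0 i) = genVal G i := by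
  rw [liftA, AlgA.gen, RingQuot.liftAlgHom_mkAlgHom_apply, FreeAlgebra.lift_ι_apply]

end

lemma gen_K_lie (s₁ s₂ : ℂ[X]) (x : AlgA s₁ s₂) : ⁅AlgA.gen s₁ s₂ .K, x⁆ = 0 := by
  obtain ⟨y, rfl⟩ := RingQuot.mkAlgHom_surjective ℂ (Rel s₁ s₂) x
  induction y using FreeAlgebra.induction with
  | grade0 z => rw [Ring.lie_def, AlgHom.commutes, Algebra.commutes, sub_self]
  | grade1 i =>
    rw [AlgA.gen, ← algHom_map_lie]
    simpa using RingQuot.mkAlgHom_rel ℂ (Rel.K_central (s₁ := s₁) (s₂ := s₂) i)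
  | mul a b ha hb =>
    rw [Ring.lie_def, sub_eq_zero] at ha hb ⊢
    rw [map_mul, ← mul_assoc, ha, mul_assoc, hb, mul_assoc]
  | add a b ha hb => rw [map_add, lie_add, ha, hb, add_zero]

lemma mk_g (i : Gen) : RingQuot.mkAlgHom ℂ (Rel 1 0) (g i) = AlgA.gen 1 0 i := rfl

/-- The tuple of generators of `A_{1,0}`. -/
noncomputable def tupleA : DiffOpTuple (AlgA 1 0) where
  K := AlgA.gen 1 0 .K
  q := AlgA.gen 1 0 .q
  p := AlgA.gen 1 0 .p
  e := AlgA.gen 1 0 .e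
  f := AlgA.gen 1 0 .f
  r := AlgA.gen 1 0 .r
  lie_K := gen_K_lie 1 0
  lie_p_q := by
    have h := RingQuot.mkAlgHom_rel ℂ (Rel.p_q (s₁ := 1) (s₂ := 0))
    simp only [algHom_map_lie, mk_g] at h
    exact h
  lie_f_q := by
    have h := RingQuot.mkAlgHom_rel ℂ (Rel.f_q (s₁ := 1) (s₂ := 0))
    simp only [algHom_map_lie, mk_g] at h
    exact h
  lie_p_f := by
    have h := RingQuot.mkAlgHom_rel ℂ (Rel.p_f (s₁ := 1) (s₂ := 0))
    simp only [algHom_map_lie, mk_g, map_zero] at h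
    exact h
  lie_e_p := by
    have h := RingQuot.mkAlgHom_rel ℂ (Rel.e_p (s₁ := 1) (s₂ := 0))
    simp only [algHom_map_lie, mk_g] at h
    exact h
  lie_f_e_f := by
    have h := RingQuot.mkAlgHom_rel ℂ (Rel.f_e_f (s₁ := 1) (s₂ := 0))
    simp only [algHom_map_lie, mk_g, map_mul, map_ofNat] at h
    simp only [Algebra.smul_def, map_ofNat]
    rw [h]
  lie_r_p := by
    have h := RingQuot.mkAlgHom_rel ℂ (Rel.r_p (s₁ := 1) (s₂ := 0))
    simp only [algHom_map_lie, mk_g] at h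
    exact h
  lie_e_r := by
    have h := RingQuot.mkAlgHom_rel ℂ (Rel.e_r (s₁ := 1) (s₂ := 0))
    simp only [algHom_map_lie, mk_g, map_zero] at h
    exact h
  lie_f_f_f_f_r := by
    have h := RingQuot.mkAlgHom_rel ℂ (Rel.f_f_f_f_r (s₁ := 1) (s₂ := 0))
    simp only [algHom_map_lie, mk_g, map_zero, adPow,
      Function.iterate_succ, Function.iterate_zero, Function.comp_apply, id_eq] at h
    exact h
  lie_e_f_r := by
    have h := RingQuot.mkAlgHom_rel ℂ (Rel.e_f_r (s₁ := 1) (s₂ := 0))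
    simp only [algHom_map_lie, mk_g, map_mul, map_ofNat] at h
    simp only [Algebra.smul_def, map_ofNat]
    rw [h]
  phi := by
    have h := RingQuot.mkAlgHom_rel ℂ (Rel.phi (s₁ := 1) (s₂ := 0))
    simp only [algHom_map_lie, mk_g, adPow, phiElt, map_sub, map_neg, map_smul, map_one, one_mul,
      Function.iterate_succ, Function.iterate_zero, Function.comp_apply, id_eq] at h
    rw [h, neg_smul]
  lie_r_r_r_f := by
    have h := RingQuot.mkAlgHom_rel ℂ (Rel.r_r_r_f (s₁ := 1) (s₂ := 0))
    simp only [algHom_map_lie, mk_g, map_zero, adPow,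
      Function.iterate_succ, Function.iterate_zero, Function.comp_apply, id_eq] at h
    exact h
  psi := by
    have h := RingQuot.mkAlgHom_rel ℂ (Rel.psi (s₁ := 1) (s₂ := 0))
    simp only [algHom_map_lie, mk_g, adPow, map_sub, map_add, map_mul, map_ofNat, map_one, mul_one,
      Function.iterate_succ, Function.iterate_zero, Function.comp_apply, id_eq] at h
    simp only [Algebra.smul_def, map_ofNat]
    rw [h]
  chi := by
    have h := RingQuot.mkAlgHom_rel ℂ (Rel.chi (s₁ := 1) (s₂ := 0))
    simp only [algHom_map_lie, mk_g, adPow, map_sub, map_mul, map_ofNat, map_zero, map_one, mul_one,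
      zero_mul, mul_zero, add_zero, Function.iterate_succ, Function.iterate_zero, Function.comp_apply, id_eq] at h
    simp only [Algebra.smul_def, map_ofNat]
    rw [h, ← mul_assoc]
    norm_num

/-- The image of a central element is central in the universal enveloping algebra. -/
lemma universalEnveloping_ι_lie {L : Type*} [LieRing L] [LieAlgebra ℂ L] {c : L}
    (hc : ∀ w : L, ⁅c, w⁆ = 0) (x : UniversalEnvelopingAlgebra ℂ L) :
    ⁅UniversalEnvelopingAlgebra.ι ℂ c, x⁆ = 0 := by
  obtain ⟨y, rfl⟩ : ∃ y, UniversalEnvelopingAlgebra.mkAlgHom ℂ L y = x :=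
    Quotient.exists_rep x
  induction y using TensorAlgebra.induction with
  | algebraMap z => rw [Ring.lie_def, AlgHom.commutes, Algebra.commutes, sub_self]
  | ι w =>
    change ⁅UniversalEnvelopingAlgebra.ι ℂ c, UniversalEnvelopingAlgebra.ι ℂ w⁆ = 0
    rw [← LieHom.map_lie, hc, map_zero]
  | mul a b ha hb =>
    rw [Ring.lie_def, sub_eq_zero] at ha hb ⊢
    rw [map_mul, ← mul_assoc, ha, mul_assoc, hb, mul_assoc]
  | add a b ha hb => rw [map_add, lie_add, ha, hb, add_zero]

end DDCA

/-! ### Generation of $\mathbb{C}[x,\partial]$ as a Lie algebra -/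

section Weyl

variable {B : Type*} [Ring B] [Algebra ℂ B] {x d : B}

lemma weyl_mul_pow {B : Type*} [Ring B] {x d : B} (h : d * x = x * d + 1) (n : ℕ) :
    d * x ^ (n + 1) = x ^ (n + 1) * d + ((n + 1 : ℕ) : B) * x ^ n := by
  induction n with
  | zero => simp [h]
  | succ n ih =>
    have e : ((n + 1 + 1 : ℕ) : B) = ((n + 1 : ℕ) : B) + 1 := by push_cast; rfl
    rw [pow_succ x (n + 1), ← mul_assoc, ih, add_mul, mul_assoc _ d x, h, e, mul_assoc, ← pow_succ]
    noncomm_ring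

lemma mem_sub_ofWeyl_smul_iff (h : d * x = x * d + 1) {z : ℂ} (hz : z ≠ 0) {b : B} :
    z • b ∈ (DiffOpTuple.ofWeyl h).sub ↔ b ∈ (DiffOpTuple.ofWeyl h).sub :=
  (DiffOpTuple.ofWeyl h).sub.toSubmodule.smul_mem_iff hz

lemma x_sq_d_mem_sub (h : d * x = x * d + 1) : x ^ 2 * d ∈ (DiffOpTuple.ofWeyl h).sub := by
  set T := DiffOpTuple.ofWeyl h
  have h1 : (1 / 2 : ℂ) • (x ^ 2 * d + x) ∈ T.sub := by
    rw [← (weyl_brackets h).1]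
    exact T.sub.lie_mem T.f_mem_sub T.r_mem_sub
  rw [mem_sub_ofWeyl_smul_iff h (by norm_num)] at h1
  have h2 := sub_mem h1 T.q_mem_sub
  rwa [show x ^ 2 * d + x - T.q = x ^ 2 * d from add_sub_cancel_right _ _] at h2

lemma pow_mem_sub (h : d * x = x * d + 1) (n : ℕ) : x ^ n ∈ (DiffOpTuple.ofWeyl h).sub := by
  induction n with
  | zero => rw [pow_zero]; exact (DiffOpTuple.ofWeyl h).K_mem_sub
  | succ n ih =>
    rcases Nat.eq_zero_or_pos n with rfl | hn
    · rw [zero_add, pow_one]; exact (DiffOpTuple.ofWeyl h).q_mem_sub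
    · obtain ⟨n, rfl⟩ := Nat.exists_eq_succ_of_ne_zero hn.ne'
      have h1 := LieSubalgebra.lie_mem _ (x_sq_d_mem_sub h) ih
      have h2 : ⁅x ^ 2 * d, x ^ (n + 1)⁆ = ((n + 1 : ℕ) : ℂ) • x ^ (n + 1 + 1) := by
        rw [Ring.lie_def, mul_assoc, weyl_mul_pow h, Algebra.smul_def, map_natCast, mul_add,
          ← mul_assoc, ← mul_assoc (x ^ (n + 1)), ← pow_add, ← pow_add, add_comm 2,
          add_sub_cancel_left, ← mul_assoc, ← Nat.cast_comm, mul_assoc, ← pow_add, add_comm 2]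
      rwa [Nat.succ_eq_add_one, h2, mem_sub_ofWeyl_smul_iff] at h1
      exact_mod_cast Nat.succ_ne_zero n

/-- Only the leading terms matter: the remainder is a multiple of one power of $x$, which
`pow_mul_pow_mem_sub` subtracts by induction on the power of $\partial$. -/
lemma weyl_sq_mul_pow (h : d * x = x * d + 1) (a : ℕ) :
    ∃ (z : ℂ) (c : ℕ), d ^ 2 * x ^ (a + 1) =
      x ^ (a + 1) * d ^ 2 + (2 : ℂ) • ((a + 1 : ℕ) : ℂ) • (x ^ a * d) + z • x ^ c := by
  have e1 : d ^ 2 * x ^ (a + 1) = x ^ (a + 1) * d ^ 2 + ((a + 1 : ℕ) : B) * (x ^ a * d)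
      + ((a + 1 : ℕ) : B) * (d * x ^ a) := by
    rw [pow_two, mul_assoc, weyl_mul_pow h, mul_add, ← mul_assoc, weyl_mul_pow h,
      ← mul_assoc d, ← Nat.cast_comm, add_mul]
    simp only [mul_assoc]
  obtain ⟨z, c, e2⟩ : ∃ (z : ℂ) (c : ℕ), d * x ^ a = x ^ a * d + z • x ^ c := by
    rcases Nat.eq_zero_or_pos a with rfl | ha
    · exact ⟨0, 0, by simp⟩
    · obtain ⟨a, rfl⟩ := Nat.exists_eq_succ_of_ne_zero ha.ne'
      exact ⟨(a + 1 : ℕ), a, by rw [Algebra.smul_def, map_natCast]; exact weyl_mul_pow h a⟩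
  refine ⟨(a + 1 : ℕ) * z, c, ?_⟩
  rw [e1, e2, ← map_natCast (algebraMap ℂ B), ← Algebra.smul_def, ← Algebra.smul_def]
  module

lemma pow_mul_pow_mem_sub (h : d * x = x * d + 1) (a b : ℕ) :
    x ^ a * d ^ b ∈ (DiffOpTuple.ofWeyl h).sub := by
  induction b generalizing a with
  | zero => rw [pow_zero, mul_one]; exact pow_mem_sub h a
  | succ b ih =>
    have h1 := LieSubalgebra.lie_mem _ (DiffOpTuple.ofWeyl h).f_mem_sub (ih (a + 1))
    obtain ⟨z, c, e⟩ := weyl_sq_mul_pow h a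
    have e' : ⁅(1 / 2 : ℂ) • d ^ 2, x ^ (a + 1) * d ^ b⁆ =
        ((a + 1 : ℕ) : ℂ) • (x ^ a * d ^ (b + 1)) + (z / 2) • (x ^ c * d ^ b) := by
      rw [Ring.lie_def, smul_mul_assoc, mul_smul_comm, ← mul_assoc, e]
      simp only [add_mul, smul_mul_assoc, mul_assoc, ← pow_add, ← pow_succ', add_comm 2 b]
      module
    have h2 := sub_mem h1 (LieSubalgebra.smul_mem _ (z / 2) (ih c))
    rw [show (DiffOpTuple.ofWeyl h).f = (1 / 2 : ℂ) • d ^ 2 from rfl, e', add_sub_cancel_right,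
      mem_sub_ofWeyl_smul_iff] at h2
    · exact h2
    · exact_mod_cast Nat.succ_ne_zero a

lemma mem_sub_of_mem_adjoin (h : d * x = x * d + 1) {b : B}
    (hb : b ∈ Algebra.adjoin ℂ ({x, d} : Set B)) : b ∈ (DiffOpTuple.ofWeyl h).sub := by
  let P : Submodule ℂ B := Submodule.span ℂ (Set.range fun i : ℕ × ℕ => x ^ i.1 * d ^ i.2)
  have hP (y : B) (hy : ∀ i j : ℕ, y * (x ^ i * d ^ j) ∈ P) (m : B) (hm : m ∈ P) : y * m ∈ P := by
    refine Submodule.span_induction (p := fun m _ => y * m ∈ P) ?_ ?_ ?_ ?_ hm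
    · rintro _ ⟨i, rfl⟩; exact hy _ _
    · rw [mul_zero]; exact zero_mem _
    · intro m n _ _ hm hn; rw [mul_add]; exact add_mem hm hn
    · intro z m _ hm; rw [mul_smul_comm]; exact P.smul_mem _ hm
  have mon (i j : ℕ) : x ^ i * d ^ j ∈ P := Submodule.subset_span ⟨(i, j), rfl⟩
  -- The span of the normally ordered monomials is stable under left multiplication by the generated
  -- algebra. Applying this to `1` puts `b` in the span.
  have h1 : ∀ m ∈ P, b * m ∈ P := by
    induction hb using Algebra.adjoin_induction with
    | mem y hy =>
      refine hP y fun i j => ?_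
      rcases hy with rfl | rfl
      · rw [← mul_assoc, ← pow_succ']; exact mon _ _
      · rcases i with _ | i
        · rw [pow_zero, one_mul, ← pow_succ']; simpa using mon 0 (j + 1)
        · rw [← mul_assoc, weyl_mul_pow h, add_mul, mul_assoc, ← pow_succ', mul_assoc,
            ← map_natCast (algebraMap ℂ B), ← Algebra.smul_def]
          exact add_mem (mon _ _) (P.smul_mem _ (mon _ _))
    | algebraMap z => intro m hm; rw [← Algebra.smul_def]; exact P.smul_mem _ hm
    | add y w _ _ hy hw => intro m hm; rw [add_mul]; exact add_mem (hy m hm) (hw m hm)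
    | mul y w _ _ hy hw => intro m hm; rw [mul_assoc]; exact hy _ (hw m hm)
  have h2 := h1 1 (by simpa using mon 0 0)
  rw [mul_one] at h2
  have h3 : P ≤ (DiffOpTuple.ofWeyl h).sub.toSubmodule := by
    refine Submodule.span_le.2 ?_
    rintro _ ⟨i, rfl⟩
    exact pow_mul_pow_mem_sub h i.1 i.2
  exact h3 h2

end Weyl

/-! ### The isomorphism with the enveloping algebra -/

namespace DDCA

section

variable {B : Type*} [Ring B] [Algebra ℂ B] (T : DiffOpTuple B)

lemma genVal_tupleA (i : Gen) : genVal tupleA i = AlgA.gen 1 0 i := by cases i <;> rfl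

lemma genVal_mem_sub (i : Gen) : genVal T i ∈ T.sub := by
  cases i
  · exact T.K_mem_sub
  · exact T.q_mem_sub
  · exact T.p_mem_sub
  · exact T.e_mem_sub
  · exact T.f_mem_sub
  · exact T.r_mem_sub

/-- The tuple in the universal enveloping algebra. -/
noncomputable def tupleU : DiffOpTuple (UniversalEnvelopingAlgebra ℂ B) :=
  T.map (UniversalEnvelopingAlgebra.ι ℂ) (universalEnveloping_ι_lie T.lie_K)

lemma genVal_tupleU (i : Gen) :
    genVal (tupleU T) i = UniversalEnvelopingAlgebra.ι ℂ (genVal T i) := by cases i <;> rfl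

/-- The Lie algebra map from the subalgebra of `A_{1,0}` generated by the tuple. -/
noncomputable def subToLie : tupleA.sub →ₗ⁅ℂ⁆ B := (liftA T).toLieHom.comp tupleA.sub.incl

lemma liftA_genVal (i : Gen) : liftA T (genVal tupleA i) = genVal T i := by
  rw [genVal_tupleA, liftA_gen]

lemma subToLie_injective (hK : T.K ≠ 0) : Function.Injective (subToLie T) := by
  refine (injective_iff_map_eq_zero _).2 fun a ha => Subtype.ext ?_
  refine tupleA.eq_zero_of_map_eq_zero (liftA T).toLieHom ?_ a.2 ha
  exact (liftA_genVal T .K).symm ▸ hK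

lemma subToLie_surjective (hT : ∀ b : B, b ∈ T.sub) : Function.Surjective (subToLie T) := by
  have h : T.sub ≤ (subToLie T).range := by
    refine LieSubalgebra.lieSpan_le.2 ?_
    rintro _ (rfl | rfl | rfl)
    · exact ⟨⟨_, tupleA.q_mem_sub⟩, liftA_genVal T .q⟩
    · exact ⟨⟨_, tupleA.f_mem_sub⟩, liftA_genVal T .f⟩
    · exact ⟨⟨_, tupleA.r_mem_sub⟩, liftA_genVal T .r⟩
  exact fun b => h (hT b)

lemma liftA_tupleU_eq (a : AlgA 1 0) (ha : a ∈ tupleA.sub) :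
    liftA (tupleU T) a = UniversalEnvelopingAlgebra.ι ℂ (liftA T a) := by
  have h (i : Gen) : liftA (tupleU T) (genVal tupleA i) =
      UniversalEnvelopingAlgebra.ι ℂ (liftA T (genVal tupleA i)) := by
    rw [liftA_genVal, liftA_genVal, genVal_tupleU]
  induction ha using LieSubalgebra.lieSpan_induction with
  | mem a ha =>
    rcases ha with rfl | rfl | rfl
    · exact h .q
    · exact h .f
    · exact h .r
  | zero => simp only [map_zero]
  | add a b _ _ ha hb => simp only [map_add, ha, hb]
  | smul z a _ ha => simp only [map_smul, ha]
  | lie a b _ _ ha hb => simp only [algHom_map_lie, LieHom.map_lie, ha, hb]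

/-- If `T` generates `B` as a Lie algebra and `T.K ≠ 0`, then `A_{1,0}` is the universal enveloping
algebra of `B`. -/
theorem exists_algEquiv (hK : T.K ≠ 0) (hT : ∀ b : B, b ∈ T.sub) :
    ∃ Φ : AlgA 1 0 ≃ₐ[ℂ] UniversalEnvelopingAlgebra ℂ B,
      ∀ i, Φ (AlgA.gen 1 0 i) = UniversalEnvelopingAlgebra.ι ℂ (genVal T i) := by
  let E : tupleA.sub ≃ₗ⁅ℂ⁆ B :=
    LieEquiv.ofBijective (subToLie T) ⟨subToLie_injective T hK, subToLie_surjective T hT⟩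
  -- A Lie section of `liftA T` with values in `sub`; its extension `Ψ` is the inverse sought.
  let ψ : B →ₗ⁅ℂ⁆ AlgA 1 0 := tupleA.sub.incl.comp E.symm.toLieHom
  have hψ (a : tupleA.sub) : ψ (liftA T a) = a := congrArg Subtype.val (E.symm_apply_apply a)
  let Ψ : UniversalEnvelopingAlgebra ℂ B →ₐ[ℂ] AlgA 1 0 := UniversalEnvelopingAlgebra.lift ℂ ψ
  have hΨ (b : B) : Ψ (UniversalEnvelopingAlgebra.ι ℂ b) = ψ b :=
    UniversalEnvelopingAlgebra.lift_ι_apply ℂ ψ b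
  refine ⟨AlgEquiv.ofAlgHom (liftA (tupleU T)) Ψ ?_ ?_, fun i => ?_⟩
  · refine UniversalEnvelopingAlgebra.hom_ext ℂ (LieHom.ext fun b => ?_)
    obtain ⟨a, rfl⟩ := subToLie_surjective T hT b
    change liftA (tupleU T) (Ψ (UniversalEnvelopingAlgebra.ι ℂ (liftA T a))) =
      UniversalEnvelopingAlgebra.ι ℂ (liftA T a)
    rw [hΨ, hψ, liftA_tupleU_eq T _ a.2]
  · refine RingQuot.ringQuot_ext' _ _ _ (FreeAlgebra.hom_ext (funext fun i => ?_))
    change Ψ (liftA (tupleU T) (AlgA.gen 1 0 i)) = AlgA.gen 1 0 i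
    rw [liftA_gen, genVal_tupleU, hΨ, ← liftA_genVal, ← genVal_tupleA]
    exact hψ ⟨_, genVal_mem_sub _ i⟩
  · rw [AlgEquiv.ofAlgHom_apply, liftA_gen, genVal_tupleU]

end

lemma opD_mul_opX : opD * opX = opX * opD + 1 := by
  refine Subtype.ext (LinearMap.ext fun u => ?_)
  have h : derivative (X * u) = X * derivative u + u := by
    rw [derivative_mul, derivative_X, one_mul, add_comm]
  exact h

/-- The tuple of generators of `ℂ[x, ∂]`. -/
noncomputable def tupleW : DiffOpTuple DiffOp := DiffOpTuple.ofWeyl opD_mul_opX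

lemma mem_sub_tupleW (b : DiffOp) : b ∈ tupleW.sub := by
  refine mem_sub_of_mem_adjoin opD_mul_opX ?_
  have h : b ∈ (⊤ : Subalgebra ℂ DiffOp) := Algebra.mem_top
  rw [← Algebra.adjoin_adjoin_coe_preimage] at h
  refine Algebra.adjoin_mono ?_ h
  rintro y (hy | hy)
  · exact Or.inl (Subtype.ext hy)
  · exact Or.inr (Subtype.ext hy)

/-! ### Representations that separate polynomials in $K$ -/

open TensorProduct in
/-- For a Lie algebra acting on `V₀` with `c` acting by `1`, there is a representation in which `c`
acts by `n + 1`. -/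
lemma exists_rep_smul {L V₀ : Type} [LieRing L] [LieAlgebra ℂ L] [AddCommGroup V₀] [Module ℂ V₀]
    [LieRingModule L V₀] [LieModule ℂ L V₀] [Nontrivial V₀] {c : L} (hc : ∀ v : V₀, ⁅c, v⁆ = v)
    (n : ℕ) :
    ∃ (V : Type) (_ : AddCommGroup V) (_ : Module ℂ V) (_ : Nontrivial V)
      (ρ : L →ₗ⁅ℂ⁆ Module.End ℂ V), ρ c = algebraMap ℂ _ ((n + 1 : ℕ) : ℂ) := by
  suffices h : ∃ (V : Type) (_ : AddCommGroup V) (_ : Module ℂ V) (_ : Nontrivial V)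
      (_ : LieRingModule L V) (_ : LieModule ℂ L V), ∀ v : V, ⁅c, v⁆ = ((n + 1 : ℕ) : ℂ) • v by
    obtain ⟨V, _, _, _, _, _, h⟩ := h
    exact ⟨V, _, _, inferInstance, LieModule.toEnd ℂ L V, LinearMap.ext h⟩
  induction n with
  | zero => exact ⟨V₀, _, _, inferInstance, _, inferInstance, by simpa using hc⟩
  | succ n ih =>
    obtain ⟨V, _, _, _, _, _, h⟩ := ih
    obtain ⟨v, hv⟩ := exists_ne (0 : V)
    have : Nontrivial (V ⊗[ℂ] V₀) := by
      refine TensorProduct.nontrivial_of_linearMap_injective_of_flat_right ℂ V V₀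
        (LinearMap.toSpanSingleton ℂ V v) ?_
      exact smul_left_injective ℂ hv
    -- On a tensor product the scalars by which `c` acts add, so each further factor $V_0$
    -- contributes 1.
    refine ⟨V ⊗[ℂ] V₀, _, _, this, _, inferInstance, fun w => ?_⟩
    induction w using TensorProduct.induction_on with
    | zero => rw [lie_zero, smul_zero]
    | tmul v v' =>
      rw [TensorProduct.LieModule.lie_tmul_right, h, hc, smul_tmul']
      push_cast
      rw [add_smul (_ + _ : ℂ), one_smul, add_tmul]
    | add v w hv hw => rw [lie_add, hv, hw, smul_add]

/-- The unit operator is transcendental in the universal enveloping algebra. -/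
lemma eq_one_of_aeval_mul {s : ℂ[X]} (h : aeval (toU 1) s * toU 1 = toU 1) : s = 1 := by
  -- Where $K$ acts by the nonzero scalar $n+1$, the identity reads $s(n+1)(n+1)=n+1$, and the
  -- factor can be cancelled.
  have ev (n : ℕ) : s.eval ((n + 1 : ℕ) : ℂ) = 1 := by
    let f : DiffOp →ₗ⁅ℂ⁆ Module.End ℂ ℂ[X] := DiffOp.val.toLieHom
    let _ : LieRingModule DiffOp ℂ[X] := LieRingModule.compLieHom ℂ[X] f
    have : LieModule ℂ DiffOp ℂ[X] := LieModule.compLieHom ℂ[X] f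
    obtain ⟨V, _, _, _, ρ, hρ⟩ := exists_rep_smul (L := DiffOp) (V₀ := ℂ[X]) (c := 1)
      (fun v => rfl) n
    have h1 := congrArg (UniversalEnvelopingAlgebra.lift ℂ ρ) h
    rw [map_mul, ← aeval_algHom_apply, UniversalEnvelopingAlgebra.lift_ι_apply, hρ,
      aeval_algebraMap_apply, ← map_mul] at h1
    have h2 := (algebraMap ℂ (Module.End ℂ V)).injective h1
    rw [coe_aeval_eq_eval] at h2
    exact mul_right_cancel₀ (Nat.cast_ne_zero.2 n.succ_ne_zero) (h2.trans (one_mul _).symm)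
  refine eq_of_infinite_eval_eq s 1 (Set.infinite_of_injective_forall_mem
    (f := fun n : ℕ => ((n + 1 : ℕ) : ℂ)) ?_ fun n => ?_)
  · intro a b hab
    simpa using hab
  · simp only [Set.mem_ofPred_eq, ev, eval_one]

end DDCA

theorem proposition4p2p20 :
    (∃ Φ : DDCA.AlgA 1 0 ≃ₐ[ℂ] DDCA.UDiffOp,
      Φ (DDCA.AlgA.gen 1 0 .K) = DDCA.toU 1 ∧
      Φ (DDCA.AlgA.gen 1 0 .q) = DDCA.toU DDCA.opX ∧
      Φ (DDCA.AlgA.gen 1 0 .p) = DDCA.toU DDCA.opD ∧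
      Φ (DDCA.AlgA.gen 1 0 .e) = DDCA.toU (-((1 / 2 : ℂ) • DDCA.opX ^ 2)) ∧
      Φ (DDCA.AlgA.gen 1 0 .f) = DDCA.toU ((1 / 2 : ℂ) • DDCA.opD ^ 2) ∧
      Φ (DDCA.AlgA.gen 1 0 .r) = DDCA.toU ((1 / 6 : ℂ) • DDCA.opX ^ 3)) ∧
    (∀ s₁ : Polynomial ℂ,
      DDCA.phiElt (DDCA.toU ((1 / 2 : ℂ) • DDCA.opD ^ 2)) (DDCA.toU ((1 / 6 : ℂ) • DDCA.opX ^ 3))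
          = -((1 / 2 : ℂ) • (Polynomial.aeval (DDCA.toU 1) s₁ * DDCA.toU 1)) ↔
        s₁ = 1) := by
  constructor
  · obtain ⟨Φ, h⟩ := DDCA.exists_algEquiv DDCA.tupleW (one_ne_zero (α := DDCA.DiffOp))
      DDCA.mem_sub_tupleW
    exact ⟨Φ, h .K, h .q, h .p, h .e, h .f, h .r⟩
  · intro s₁
    have h : DDCA.phiElt (DDCA.toU ((1 / 2 : ℂ) • DDCA.opD ^ 2))
        (DDCA.toU ((1 / 6 : ℂ) • DDCA.opX ^ 3)) = (-(1 / 2) : ℂ) • DDCA.toU 1 :=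
      (DDCA.tupleU DDCA.tupleW).phi
    rw [h, neg_smul, neg_inj]
    constructor
    · intro h'
      exact DDCA.eq_one_of_aeval_mul (smul_right_injective _ (by norm_num : (1 / 2 : ℂ) ≠ 0) h').symm
    · rintro rfl
      rw [map_one (Polynomial.aeval (DDCA.toU 1)), one_mul]
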